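/- For $0<\alpha\le 2$ let $f(x;\alpha)=\frac1{2\pi}\int_{-\infty}^{\infty}e^{-itx}e^{-|t|^{\alpha}}\,dt$ $(x\in\mathbb R)$ be the standard symmetric stable density, with characteristic function $e^{-|t|^\alpha}$. Then $f(x;\alpha)$ is twice continuously differentiable in $x\in\mathbb R$ and, for each fixed $x$, in $\alpha\in(0,2]$ (one-sidedly at $\alpha=2$). Write $f',f''$ for the derivatives in $x$ and $f_\alpha,f_{\alpha\alpha}$ for the derivatives in $\alpha$. Consider the following series. At zero: $$f'(x;\alpha)=\frac1{\pi\alpha}\sum_{k=1}^\infty\frac{\Gamma((2k+1)/\alpha)}{(2k-1)!}(-1)^kx^{2k-1},\qquad (1)$$ $$f''(x;\alpha)=\frac1{\pi\alpha}\sum_{k=1}^\infty\frac{\Gamma((2k+1)/\alpha)}{(2k-2)!}(-1)^kx^{2k-2},\qquad (2)$$ $$f_\alpha(x;\alpha)=-\frac1{\pi\alpha^2}\sum_{k=0}^\infty\frac{\Gamma'((2k+1)/\alpha+1)}{(2k)!}(-x^2)^k,\qquad (3)$$ $$f_{\alpha\alpha}(x;\alpha)=\frac2{\pi\alpha^3}\sum_{k=0}^\infty\frac{\Gamma'((2k+1)/\alpha+1)}{(2k)!}(-x^2)^k+\frac1{\pi\alpha^4}\sum_{k=0}^\infty\frac{\Gamma''((2k+1)/\alpha+1)}{(2k)!}(2k+1)(-x^2)^k.\qquad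 (4)$$ At infinity ($x>0$), with $S_k=\sin(\pi\alpha k/2)$ and $C_k=\cos(\pi\alpha k/2)$: $$f'(x;\alpha)=\frac1\pi\sum_{k=1}^\infty\frac{\Gamma(\alpha k+2)}{k!}(-1)^kS_k\,x^{-k\alpha-2},\qquad (5)$$ $$f''(x;\alpha)=\frac1\pi\sum_{k=1}^\infty\frac{\Gamma(\alpha k+3)}{k!}(-1)^{k-1}S_k\,x^{-k\alpha-3},\qquad (6)$$ $$f_\alpha(x;\alpha)=\frac1\pi\sum_{k=1}^\infty\frac{\Gamma'(\alpha k+1)}{(k-1)!}(-1)^{k-1}S_k\,x^{-k\alpha-1}+\frac1\pi\sum_{k=1}^\infty\frac{\Gamma(\alpha k+1)}{(k-1)!}(-1)^{k-1}\Big[\frac\pi2C_k-\log x\,S_k\Big]x^{-k\alpha-1},\qquad (7)$$ $$\begin{aligned}f_{\alpha\alpha}(x;\alpha)={}&\frac1\pi\sum_{k=1}^\infty\frac{\Gamma''(\alpha k+1)}{(k-1)!}k(-1)^{k-1}S_k\,x^{-k\alpha-1}-\frac2\pi\sum_{k=1}^\infty\frac{\Gamma'(\alpha k+1)}{(k-1)!}k(-1)^k\Big[\frac\pi2C_k-\log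 x\,S_k\Big]x^{-k\alpha-1}\\&+\frac1\pi\sum_{k=1}^\infty\frac{\Gamma(\alpha k+1)}{(k-1)!}k(-1)^{k-1}\Big[\Big(\log^2x-\frac{\pi^2}4\Big)S_k-\pi\log x\,C_k\Big]x^{-k\alpha-1}.\end{aligned}\qquad (8)$$ (a) If $1<\alpha\le2$, the series in (1)–(4) converge and the equalities (1)–(4) hold for every real $x$, while (5)–(8) hold as asymptotic expansions as $x\to\infty$. (b) If $0<\alpha<1$, the series in (5)–(8) converge and the equalities (5)–(8) hold for every $x>0$ (hence, by evenness of $f$ in $x$, for every $x\ne0$ with $x$ replaced by $|x|$ on the right-hand side, and in (5) the right-hand side multiplied by the sign of $x$), while (1)–(4) hold as asymptotic expansions as $x\to0$. Here "asymptotic expansion" means that for every $N\ge0$ the difference between the function and the sum of the first $N$ terms (in (4), (7), (8) the separate sums being truncated at the same $N$ and added) is $O$ of the gauge function of the first omitted term. The gauge functions of the term with index $k$ are $x^{2k-1}$, $x^{2k-2}$, $x^{2k}$, $x^{2k}$ in (1)–(4), and $x^{-k\alpha-2}$, $x^{-k\alpha-3}$, $x^{-k\alpha-1}\log x$, $x^{-k\alpha-1}\log^2x$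 in (5)–(8). -/

import Mathlib

open Filter Topology Asymptotics MeasureTheory

namespace SymStable

/-- The characteristic function `Φ(t; α) = exp (-|t| ^ α)` of the standard symmetric stable law. -/
noncomputable def charFn (α t : ℝ) : ℝ := Real.exp (-|t| ^ α)

/-- The standard symmetric stable density `f(x; α)`, by Fourier inversion of `Φ(·; α)`, which is
even and real:
`f(x; α) = (1 / 2π) ∫ exp (-i t x) Φ(t; α) dt = (1 / 2π) ∫ cos (t x) Φ(t; α) dt`. -/
noncomputable def density (x α : ℝ) : ℝ :=
  1 / (2 * Real.pi) * ∫ t : ℝ, Real.cos (t * x) * charFn α t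

/-- `Φ(·; α)` is integrable for every `α > 0`. -/
theorem integrable_charFn {α : ℝ} (hα : 0 < α) : Integrable (charFn α) := by
  have h := integrableOn_rpow_mul_exp_neg_rpow (s := 0) (p := α) (by norm_num) hα
  simp only [Real.rpow_zero, one_mul] at h
  have h1 : IntegrableOn (charFn α) (Set.Ioi 0) := by
    refine h.congr_fun (fun x hx => ?_) measurableSet_Ioi
    simp [charFn, abs_of_pos (Set.mem_Ioi.mp hx)]
  have h2 : IntegrableOn (charFn α) (Set.Iic 0) := by
    have h3 := (integrableOn_Ici_iff_integrableOn_Ioi).mpr h1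
    have h4 : IntegrableOn (fun t => charFn α (-t)) (Set.Iic 0) := by
      have := (Measure.measurePreserving_neg (volume : Measure ℝ)).integrableOn_comp_preimage
        (Homeomorph.neg ℝ).measurableEmbedding (f := charFn α) (s := Set.Ici 0)
      have h5 := this.mpr h3
      simpa [Function.comp_def] using h5
    refine h4.congr_fun (fun x _ => ?_) measurableSet_Iic
    simp [charFn]
  rw [← integrableOn_univ, ← Set.Iic_union_Ioi (a := (0 : ℝ))]
  exact h2.union h1

/-- `density · α` is the only candidate for the density: a continuous integrable function with
characteristic function `Φ(·; α)` equals `density · α`. -/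
theorem eq_density_of_charFn {α : ℝ} (hα : 0 < α) {p : ℝ → ℝ} (hc : Continuous p)
    (hi : Integrable p)
    (h : ∀ t : ℝ, ∫ x : ℝ, Complex.exp (t * x * Complex.I) * (p x : ℂ) = (charFn α t : ℂ))
    (x : ℝ) : p x = density x α := by
  have hF : ∀ w : ℝ, FourierTransform.fourier (fun x : ℝ => (p x : ℂ)) w
      = (charFn α (2 * Real.pi * w) : ℂ) := by
    intro w
    have hw := h (-(2 * Real.pi * w))
    have he : charFn α (-(2 * Real.pi * w)) = charFn α (2 * Real.pi * w) := by
      simp only [charFn, abs_neg]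
    rw [he] at hw
    rw [← hw, Real.fourier_real_eq_integral_exp_smul]
    refine integral_congr_ae (Eventually.of_forall fun y => ?_)
    simp only [smul_eq_mul]
    congr 2
    push_cast
    ring
  have hΦ : Integrable (fun w : ℝ => (charFn α (2 * Real.pi * w) : ℂ)) :=
    ((integrable_charFn hα).comp_mul_left' (by positivity)).ofReal
  have hinv := Continuous.fourierInv_fourier_eq (f := fun x : ℝ => (p x : ℂ))
    (Complex.continuous_ofReal.comp hc) hi.ofReal
    (by rw [show FourierTransform.fourier (fun x : ℝ => (p x : ℂ))
          = fun w : ℝ => (charFn α (2 * Real.pi * w) : ℂ) from funext hF]; exact hΦ)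
  have hx := congrFun hinv x
  rw [Real.fourierInv_eq'] at hx
  have hint : Integrable (fun v : ℝ =>
      Complex.exp ((2 * Real.pi * inner ℝ v x : ℝ) * Complex.I) •
        FourierTransform.fourier (fun x : ℝ => (p x : ℂ)) v) := by
    simp only [hF, smul_eq_mul]
    refine hΦ.bdd_mul (c := 1) ?_ ?_
    · exact Continuous.aestronglyMeasurable (by fun_prop)
    · exact Eventually.of_forall fun v => (Complex.norm_exp_ofReal_mul_I _).le
  have hre := congrArg Complex.re hx
  rw [Complex.ofReal_re] at hre
  rw [← hre, ← Complex.reCLM_apply, ← ContinuousLinearMap.integral_comp_comm _ hint]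
  have hsub := Measure.integral_comp_mul_left
    (fun t : ℝ => Real.cos (t * x) * charFn α t) (2 * Real.pi)
  rw [abs_of_pos (by positivity), smul_eq_mul] at hsub
  rw [density, one_div, ← hsub]
  refine integral_congr_ae (Eventually.of_forall fun v => ?_)
  simp only [hF, smul_eq_mul, Complex.reCLM_apply, Complex.re_mul_ofReal,
    Complex.exp_ofReal_mul_I_re]
  congr 2
  simp only [RCLike.inner_apply, conj_trivial]
  ring

/-- `f'(x; α)`, the first derivative in `x`. -/
noncomputable def densityX (x α : ℝ) : ℝ := deriv (fun y => density y α) x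

/-- `f''(x; α)`, the second derivative in `x`. -/
noncomputable def densityXX (x α : ℝ) : ℝ := iteratedDeriv 2 (fun y => density y α) x

/-- `f_α(x; α)`, the first derivative in the exponent, over the parameter range `(0, 2]`
(so one-sided at `α = 2`). -/
noncomputable def densityA (x α : ℝ) : ℝ :=
  derivWithin (fun a => density x a) (Set.Ioc 0 2) α

/-- `f_αα(x; α)`, the second derivative in the exponent, over the parameter range `(0, 2]`
(so one-sided at `α = 2`). -/
noncomputable def densityAA (x α : ℝ) : ℝ :=
  iteratedDerivWithin 2 (fun a => density x a) (Set.Ioc 0 2) α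

/-- `F ~ u 0 + u 1 + u 2 + ⋯` is an asymptotic expansion along `l` with respect to the gauge
functions `φ`: they form an asymptotic scale, and the remainder of the partial sum of the first
`N` terms is of the order of the gauge of the first omitted term. -/
def HasAsymptoticExpansion (F : ℝ → ℝ) (u φ : ℕ → ℝ → ℝ) (l : Filter ℝ) : Prop :=
  (∀ N : ℕ, φ (N + 1) =o[l] φ N) ∧
    ∀ N : ℕ, (fun x => F x - ∑ k ∈ Finset.range N, u k x) =O[l] φ N

/-! The terms of the series, `k` being the summation index. In `xZero`, `xxZero` and all terms at
infinity `k` starts from `1`, so that the subtractions in the factorials and the natural exponents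
are genuine. The terms at infinity are meant for `x > 0`. -/

/-- Term `k ≥ 1` of the series of `f'` at zero. -/
noncomputable def xZero (α : ℝ) (k : ℕ) (x : ℝ) : ℝ :=
  1 / (Real.pi * α) *
    (Real.Gamma ((2 * k + 1) / α) / (2 * k - 1).factorial * (-1) ^ k * x ^ (2 * k - 1))

/-- Term `k ≥ 1` of the series of `f'` at infinity. -/
noncomputable def xInf (α : ℝ) (k : ℕ) (x : ℝ) : ℝ :=
  1 / Real.pi *
    (Real.Gamma (α * k + 2) / k.factorial * (-1) ^ k * Real.sin (Real.pi * α * k / 2) *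
      x ^ (-(k * α) - 2))

/-- Term `k ≥ 1` of the series of `f''` at zero. -/
noncomputable def xxZero (α : ℝ) (k : ℕ) (x : ℝ) : ℝ :=
  1 / (Real.pi * α) *
    (Real.Gamma ((2 * k + 1) / α) / (2 * k - 2).factorial * (-1) ^ k * x ^ (2 * k - 2))

/-- Term `k ≥ 1` of the series of `f''` at infinity. -/
noncomputable def xxInf (α : ℝ) (k : ℕ) (x : ℝ) : ℝ :=
  1 / Real.pi *
    (Real.Gamma (α * k + 3) / k.factorial * (-1) ^ (k - 1) * Real.sin (Real.pi * α * k / 2) *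
      x ^ (-(k * α) - 3))

/-- Term `k ≥ 0` of the series of `f_α` at zero. -/
noncomputable def aZero (α : ℝ) (k : ℕ) (x : ℝ) : ℝ :=
  -(1 / (Real.pi * α ^ 2)) *
    (deriv Real.Gamma ((2 * k + 1) / α + 1) / (2 * k).factorial * (-(x ^ 2)) ^ k)

/-- Term `k ≥ 1` of the first series of `f_α` at infinity (with `Γ'`). -/
noncomputable def aInf₁ (α : ℝ) (k : ℕ) (x : ℝ) : ℝ :=
  1 / Real.pi *
    (deriv Real.Gamma (α * k + 1) / (k - 1).factorial * (-1) ^ (k - 1) *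
      Real.sin (Real.pi * α * k / 2) * x ^ (-(k * α) - 1))

/-- Term `k ≥ 1` of the second series of `f_α` at infinity (with `Γ`). -/
noncomputable def aInf₂ (α : ℝ) (k : ℕ) (x : ℝ) : ℝ :=
  1 / Real.pi *
    (Real.Gamma (α * k + 1) / (k - 1).factorial * (-1) ^ (k - 1) *
      (Real.pi / 2 * Real.cos (Real.pi * α * k / 2) -
        Real.log x * Real.sin (Real.pi * α * k / 2)) * x ^ (-(k * α) - 1))

/-- Term `k ≥ 0` of the first series of `f_αα` at zero (with `Γ'`). -/
noncomputable def aaZero₁ (α : ℝ) (k : ℕ) (x : ℝ) : ℝ :=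
  2 / (Real.pi * α ^ 3) *
    (deriv Real.Gamma ((2 * k + 1) / α + 1) / (2 * k).factorial * (-(x ^ 2)) ^ k)

/-- Term `k ≥ 0` of the second series of `f_αα` at zero (with `Γ''`). -/
noncomputable def aaZero₂ (α : ℝ) (k : ℕ) (x : ℝ) : ℝ :=
  1 / (Real.pi * α ^ 4) *
    (iteratedDeriv 2 Real.Gamma ((2 * k + 1) / α + 1) / (2 * k).factorial * (2 * k + 1) *
      (-(x ^ 2)) ^ k)

/-- Term `k ≥ 1` of the first series of `f_αα` at infinity (with `Γ''`). -/
noncomputable def aaInf₁ (α : ℝ) (k : ℕ) (x : ℝ) : ℝ :=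
  1 / Real.pi *
    (iteratedDeriv 2 Real.Gamma (α * k + 1) / (k - 1).factorial * k * (-1) ^ (k - 1) *
      Real.sin (Real.pi * α * k / 2) * x ^ (-(k * α) - 1))

/-- Term `k ≥ 1` of the second series of `f_αα` at infinity (with `Γ'`). -/
noncomputable def aaInf₂ (α : ℝ) (k : ℕ) (x : ℝ) : ℝ :=
  -(2 / Real.pi) *
    (deriv Real.Gamma (α * k + 1) / (k - 1).factorial * k * (-1) ^ k *
      (Real.pi / 2 * Real.cos (Real.pi * α * k / 2) -
        Real.log x * Real.sin (Real.pi * α * k / 2)) * x ^ (-(k * α) - 1))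

/-- Term `k ≥ 1` of the third series of `f_αα` at infinity (with `Γ`). -/
noncomputable def aaInf₃ (α : ℝ) (k : ℕ) (x : ℝ) : ℝ :=
  1 / Real.pi *
    (Real.Gamma (α * k + 1) / (k - 1).factorial * k * (-1) ^ (k - 1) *
      ((Real.log x ^ 2 - Real.pi ^ 2 / 4) * Real.sin (Real.pi * α * k / 2) -
        Real.pi * Real.log x * Real.cos (Real.pi * α * k / 2)) * x ^ (-(k * α) - 1))

end SymStable

namespace SymStable

/-! By evenness, `f(x; α)` is `1/π` times the real part of `∫ exp(izx - z^α) dz` over the positive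
half-line (`density_eq`). A derivative in `x` inserts a factor `iz`. With `w = z^α`, a derivative in
`α` inserts `log z` and applies the Euler operator `w d/dw` to `exp(-w)`. The integrals `rayInt`
form a family closed under both operations, so every function in the theorem is the real part of one
of them.

At zero, `exp(izx)` is expanded in powers of `x`. The coefficients are `rayInt` at `x = 0`: Gamma
integrals for `j = 0`, and derivatives of these in `α` for `j = 1, 2`. If `α > 1`, the decay of
`exp(-s^α)` beats `exp(s|x|)` and the expansion may be integrated termwise (`hasSum_rayInt_origin`).
For any `α > 0`, `exp(izx)` has modulus one on the half-line, so its Taylor remainder is of the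
order of the first omitted power (`exists_norm_rayInt_sub_le`).

At infinity, the factor to expand is the one in `w = z^α`, but on the real half-line the resulting
moments do not converge absolutely. For `x > 0` the ray is first turned to the angle `π/6`
(`rayInt_eq`), where `exp(izx)` decays exponentially and, since `α < 3`, `exp(-z^α)` still decays.
The moments `rayMom` are evaluated by turning further to the imaginary axis, where they are Gamma
integrals, and by differentiating in the exponent `p` to create powers of `log z`. If `α < 1`,
`exp(izx)` dominates the whole series in `z^α` (`hasSum_rayInt`). Otherwise the function of `w` is
bounded in the sector that is swept, which controls its Taylor remainder
(`exists_norm_rayInt_sub_rayMom_le`).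

The series with `Γ'` and `Γ''` must also converge separately; at infinity this follows from bounding
these derivatives by moments at `x = 1`. -/

/-- The polynomials `p j` with `(w d/dw)^j exp (-w) = p j (w) * exp (-w)`. -/
noncomputable def eulerPoly : ℕ → Polynomial ℂ
  | 0 => 1
  | j + 1 => Polynomial.X * (Polynomial.derivative (eulerPoly j) - eulerPoly j)

/-- `eulerExp j w = (w d/dw)^j exp (-w)`. -/
noncomputable def eulerExp (j : ℕ) (w : ℂ) : ℂ := (eulerPoly j).eval w * Complex.exp (-w)

/-- The logarithm of the point at distance `s` from the origin on the ray of argument `θ`. -/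
noncomputable def rayLog (θ s : ℝ) : ℂ := Real.log s + θ * Complex.I

/-- `∂_x^m ∂_α^j` of `exp (i z x - z ^ α)` at the point `z` of the ray of argument `θ` at distance
`s` from the origin, multiplied by `exp (i θ)`. -/
noncomputable def rayFn (θ : ℝ) (m j : ℕ) (x α s : ℝ) : ℂ :=
  Complex.exp (θ * Complex.I) * (Complex.I * Complex.exp (rayLog θ s)) ^ m * rayLog θ s ^ j *
    eulerExp j (Complex.exp (α * rayLog θ s)) *
    Complex.exp (Complex.I * Complex.exp (rayLog θ s) * x)

/-- The integral of `∂_x^m ∂_α^j exp (i z x - z ^ α)` along the ray of argument `θ`. -/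
noncomputable def rayInt (θ : ℝ) (m j : ℕ) (x α : ℝ) : ℂ :=
  ∫ s in Set.Ioi (0 : ℝ), rayFn θ m j x α s

/-- `(i z) ^ m (log z) ^ j z ^ p exp (i z x)` along the ray of argument `θ`, multiplied by
`exp (i θ)`. -/
noncomputable def rayMomFn (θ : ℝ) (m j : ℕ) (x p s : ℝ) : ℂ :=
  Complex.exp (θ * Complex.I) * (Complex.I * Complex.exp (rayLog θ s)) ^ m * rayLog θ s ^ j *
    Complex.exp (p * rayLog θ s) * Complex.exp (Complex.I * Complex.exp (rayLog θ s) * x)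

/-- The integral of `(i z) ^ m (log z) ^ j z ^ p exp (i z x)` along the ray of argument `θ`. -/
noncomputable def rayMom (θ : ℝ) (m j : ℕ) (x p : ℝ) : ℂ :=
  ∫ s in Set.Ioi (0 : ℝ), rayMomFn θ m j x p s

/-! ### Moduli and measurability along a ray. -/

theorem exp_rayLog {s : ℝ} (hs : 0 < s) (θ : ℝ) :
    Complex.exp (rayLog θ s) = s * Complex.exp (θ * Complex.I) := by
  rw [rayLog, Complex.exp_add, ← Complex.ofReal_exp, Real.exp_log hs]

theorem exp_mul_rayLog {s : ℝ} (hs : 0 < s) (θ a : ℝ) :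
    Complex.exp (a * rayLog θ s) = (s ^ a : ℝ) * Complex.exp ((a * θ : ℝ) * Complex.I) := by
  rw [rayLog, mul_add, Complex.exp_add, Real.rpow_def_of_pos hs]
  push_cast
  ring_nf

theorem norm_exp_rayLog {s : ℝ} (hs : 0 < s) (θ : ℝ) : ‖Complex.exp (rayLog θ s)‖ = s := by
  rw [exp_rayLog hs, norm_mul, Complex.norm_exp_ofReal_mul_I, mul_one, Complex.norm_real,
    Real.norm_of_nonneg hs.le]

theorem norm_exp_mul_rayLog {s : ℝ} (hs : 0 < s) (θ a : ℝ) :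
    ‖Complex.exp (a * rayLog θ s)‖ = s ^ a := by
  rw [exp_mul_rayLog hs, norm_mul, Complex.norm_exp_ofReal_mul_I, mul_one, Complex.norm_real,
    Real.norm_of_nonneg (Real.rpow_nonneg hs.le _)]

theorem re_exp_mul_rayLog {s : ℝ} (hs : 0 < s) (θ a : ℝ) :
    (Complex.exp (a * rayLog θ s)).re = s ^ a * Real.cos (a * θ) := by
  rw [exp_mul_rayLog hs, Complex.re_ofReal_mul, Complex.exp_ofReal_mul_I_re]

theorem norm_exp_I_mul_exp_rayLog {s : ℝ} (hs : 0 < s) (θ x : ℝ) :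
    ‖Complex.exp (Complex.I * Complex.exp (rayLog θ s) * x)‖ =
      Real.exp (-(x * Real.sin θ) * s) := by
  rw [Complex.norm_exp, exp_rayLog hs]
  congr 1
  rw [Complex.re_mul_ofReal, Complex.I_mul_re, Complex.im_ofReal_mul, Complex.exp_ofReal_mul_I_im]
  ring

theorem norm_rayLog_le (θ s : ℝ) : ‖rayLog θ s‖ ≤ |Real.log s| + |θ| := by
  refine (norm_add_le _ _).trans ?_
  simp

theorem measurable_rayLog (θ : ℝ) : Measurable (rayLog θ) := by
  unfold rayLog
  fun_prop

theorem continuous_eulerExp (j : ℕ) : Continuous (eulerExp j) := by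
  unfold eulerExp
  fun_prop

theorem measurable_rayFn (θ : ℝ) (m j : ℕ) (x α : ℝ) : Measurable (rayFn θ m j x α) := by
  have h1 := measurable_rayLog θ
  have h2 := (continuous_eulerExp j).measurable
  unfold rayFn
  fun_prop

theorem measurable_rayMomFn (θ : ℝ) (m j : ℕ) (x p : ℝ) : Measurable (rayMomFn θ m j x p) := by
  have h1 := measurable_rayLog θ
  unfold rayMomFn
  fun_prop

/-! ### The Euler operator on `exp(-w)`: derivatives and decay in a sector. -/

theorem hasDerivAt_eulerExp (j : ℕ) (w : ℂ) :
    HasDerivAt (eulerExp j)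
      (((Polynomial.derivative (eulerPoly j)).eval w - (eulerPoly j).eval w) *
        Complex.exp (-w)) w := by
  have h := ((eulerPoly j).hasDerivAt w).mul ((hasDerivAt_id w).neg.cexp)
  refine h.congr_deriv ?_
  simp only [Pi.neg_apply, id]
  ring

theorem eulerExp_succ (j : ℕ) (w : ℂ) :
    eulerExp (j + 1) w =
      w * (((Polynomial.derivative (eulerPoly j)).eval w - (eulerPoly j).eval w) *
        Complex.exp (-w)) := by
  simp only [eulerExp, eulerPoly, Polynomial.eval_mul, Polynomial.eval_X, Polynomial.eval_sub]
  ring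

/-- Chain rule: since `w = exp(az)` satisfies `dw/da = zw`, differentiating in `a` is `z` times the
Euler operator. -/
theorem hasDerivAt_eulerExp_exp (j : ℕ) (z : ℂ) (α : ℝ) :
    HasDerivAt (fun a : ℝ => eulerExp j (Complex.exp (a * z)))
      (z * eulerExp (j + 1) (Complex.exp (α * z))) α := by
  have h1 : HasDerivAt (fun a : ℝ => Complex.exp (a * z)) (Complex.exp (α * z) * z) α := by
    have : HasDerivAt (fun a : ℝ => (a : ℂ) * z) z α := by
      simpa using (Complex.ofRealCLM.hasDerivAt (x := α)).mul_const z
    exact this.cexp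
  refine ((hasDerivAt_eulerExp j _).comp α h1).congr_deriv ?_
  rw [eulerExp_succ]
  ring

theorem exists_norm_eval_le (p : Polynomial ℂ) {c : ℝ} (hc : 0 < c) :
    ∃ C, 0 ≤ C ∧ ∀ w : ℂ, ‖p.eval w‖ ≤ C * Real.exp (c * ‖w‖) := by
  induction p using Polynomial.induction_on' with
  | add p q hp hq =>
    obtain ⟨C, hC, h⟩ := hp
    obtain ⟨D, hD, h'⟩ := hq
    refine ⟨C + D, by positivity, fun w => ?_⟩
    rw [Polynomial.eval_add, add_mul]
    exact (norm_add_le _ _).trans (add_le_add (h w) (h' w))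
  | monomial n a =>
    refine ⟨‖a‖ * (n.factorial / c ^ n), by positivity, fun w => ?_⟩
    rw [Polynomial.eval_monomial, norm_mul, norm_pow, mul_assoc]
    gcongr
    have := Real.pow_div_factorial_le_exp (c * ‖w‖) (by positivity) n
    rw [div_le_iff₀ (by positivity), mul_pow] at this
    rw [div_mul_eq_mul_div, le_div_iff₀ (by positivity)]
    linarith

/-- In the sector `c‖w‖ ≤ Re w` the exponential decays at rate `c`; half of that rate absorbs the
polynomial factor. -/
theorem exists_norm_eulerExp_le (j : ℕ) {c : ℝ} (hc : 0 < c) :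
    ∃ C, 0 ≤ C ∧ ∀ w : ℂ, c * ‖w‖ ≤ w.re → ‖eulerExp j w‖ ≤ C * Real.exp (-(c / 2) * ‖w‖) := by
  obtain ⟨C, hC, h⟩ := exists_norm_eval_le (eulerPoly j) (half_pos hc)
  refine ⟨C, hC, fun w hw => ?_⟩
  rw [eulerExp, norm_mul, Complex.norm_exp, Complex.neg_re]
  calc _ ≤ C * Real.exp (c / 2 * ‖w‖) * Real.exp (-(c * ‖w‖)) := by
        gcongr
        exact h w
    _ = _ := by
        rw [mul_assoc, ← Real.exp_add]
        congr 2
        ring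

/-! ### Integrable majorants. -/

/-- From `t^j ≤ 2^j j! exp(t/2)` with `t = |log s| + |b|`. The price of any power of the logarithm
is thus only `s^(±1/2)`, whence the condition `-1/2 < q` for the majorants. -/
theorem abs_log_add_pow_le (b : ℝ) (j : ℕ) : ∃ C, 0 ≤ C ∧ ∀ s : ℝ, 0 < s →
    (|Real.log s| + |b|) ^ j ≤ C * (s ^ (1 / 2 : ℝ) + s ^ (-1 / 2 : ℝ)) := by
  refine ⟨2 ^ j * j.factorial * Real.exp (|b| / 2), by positivity, fun s hs => ?_⟩
  have h := Real.pow_div_factorial_le_exp ((|Real.log s| + |b|) / 2) (by positivity) j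
  rw [div_le_iff₀ (by positivity), div_pow, div_le_iff₀ (by positivity)] at h
  refine h.trans ?_
  have h2 : Real.exp (|Real.log s| / 2) ≤ s ^ (1 / 2 : ℝ) + s ^ (-1 / 2 : ℝ) := by
    rw [Real.rpow_def_of_pos hs, Real.rpow_def_of_pos hs]
    rcases abs_cases (Real.log s) with ⟨h, -⟩ | ⟨h, -⟩ <;> rw [h]
    · refine le_add_of_le_of_nonneg (Real.exp_le_exp.2 (by linarith)) (Real.exp_nonneg _)
    · refine le_add_of_nonneg_of_le (Real.exp_nonneg _) (Real.exp_le_exp.2 (by linarith))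
  rw [add_div, Real.exp_add]
  calc _ = 2 ^ j * j.factorial * Real.exp (|b| / 2) * Real.exp (|Real.log s| / 2) := by ring
    _ ≤ _ := by gcongr

/-- The common majorant of the integrands. -/
noncomputable def majorant (b q : ℝ) (j : ℕ) (c a s : ℝ) : ℝ :=
  s ^ q * (|Real.log s| + |b|) ^ j * Real.exp (-c * s ^ a)

theorem integrableOn_majorant (b : ℝ) {q : ℝ} (hq : -1 / 2 < q) (j : ℕ) {c a : ℝ} (hc : 0 < c)
    (ha : 0 < a) : IntegrableOn (majorant b q j c a) (Set.Ioi 0) := by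
  obtain ⟨C, hC, h⟩ := abs_log_add_pow_le b j
  have h1 := integrableOn_rpow_mul_exp_neg_mul_rpow (p := a) (s := q + 1 / 2) (b := c)
    (by linarith) ha hc
  have h2 := integrableOn_rpow_mul_exp_neg_mul_rpow (p := a) (s := q + -1 / 2) (b := c)
    (by linarith) ha hc
  refine Integrable.mono' ((h1.add h2).const_mul C) ?_ ?_
  · unfold majorant
    exact Measurable.aestronglyMeasurable (by fun_prop)
  · refine (ae_restrict_iff' measurableSet_Ioi).2 (Eventually.of_forall fun s hs => ?_)
    have hs : 0 < s := hs
    rw [Real.norm_of_nonneg (by unfold majorant; positivity)]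
    simp only [Pi.add_apply, Real.rpow_add hs, majorant]
    calc _ ≤ s ^ q * (C * (s ^ (1 / 2 : ℝ) + s ^ (-1 / 2 : ℝ))) * Real.exp (-c * s ^ a) := by
          gcongr
          exact h s hs
      _ = _ := by ring

theorem ae_Ioi {P : ℝ → Prop} (h : ∀ s : ℝ, 0 < s → P s) :
    ∀ᵐ s ∂volume.restrict (Set.Ioi (0 : ℝ)), P s :=
  (ae_restrict_iff' measurableSet_Ioi).2 (Eventually.of_forall fun s hs => h s hs)

/-- Replaces a varying exponent `α` by a fixed lower bound `a`, at the cost of a constant factor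
after exponentiation. -/
theorem sub_one_le_rpow {s a α : ℝ} (hs : 0 < s) (ha : 0 < a) (hα : a ≤ α) :
    s ^ a - 1 ≤ s ^ α := by
  rcases le_total 1 s with h | h
  · linarith [Real.rpow_le_rpow_of_exponent_le h hα]
  · linarith [Real.rpow_le_one hs.le h ha.le, Real.rpow_nonneg hs.le α]

theorem majorant_nonneg (b q : ℝ) (j : ℕ) (c a : ℝ) {s : ℝ} (hs : 0 < s) :
    0 ≤ majorant b q j c a s := by
  unfold majorant
  positivity

/-! ### Differentiation of ray integrals in `x` and in `α`. -/

/-- The constant depends only on `j` and `c`, so the bound is uniform over nearby `α` and `x`, as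
dominated differentiation needs. -/
theorem exists_norm_rayFn_le (j : ℕ) {c : ℝ} (hc : 0 < c) : ∃ C, 0 ≤ C ∧
    ∀ (θ : ℝ) (m : ℕ) (x α a s : ℝ), 0 < a → a ≤ α → c ≤ Real.cos (α * θ) →
      0 ≤ x * Real.sin θ → 0 < s → ‖rayFn θ m j x α s‖ ≤ C * majorant θ m j (c / 2) a s := by
  obtain ⟨C, hC, h⟩ := exists_norm_eulerExp_le j hc
  refine ⟨C * Real.exp (c / 2), by positivity, fun θ m x α a s ha hα hcos hx hs => ?_⟩
  have h1 : ‖eulerExp j (Complex.exp (α * rayLog θ s))‖ ≤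
      C * Real.exp (c / 2) * Real.exp (-(c / 2) * s ^ a) := by
    refine (h _ ?_).trans ?_
    · rw [norm_exp_mul_rayLog hs, re_exp_mul_rayLog hs, mul_comm]
      gcongr
    · rw [mul_assoc, ← Real.exp_add, norm_exp_mul_rayLog hs]
      gcongr
      have := sub_one_le_rpow hs ha hα
      nlinarith
  have h2 : ‖Complex.exp (Complex.I * Complex.exp (rayLog θ s) * x)‖ ≤ 1 := by
    rw [norm_exp_I_mul_exp_rayLog hs]
    exact Real.exp_le_one_iff.2 (by nlinarith)
  have h3 : ‖rayLog θ s ^ j‖ ≤ (|Real.log s| + |θ|) ^ j := by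
    rw [norm_pow]
    gcongr
    exact norm_rayLog_le θ s
  have h4 : ‖(Complex.I * Complex.exp (rayLog θ s)) ^ m‖ = s ^ (m : ℝ) := by
    rw [norm_pow, norm_mul, Complex.norm_I, one_mul, norm_exp_rayLog hs, Real.rpow_natCast]
  rw [rayFn, norm_mul, norm_mul, norm_mul, norm_mul, Complex.norm_exp_ofReal_mul_I, h4, majorant,
    one_mul]
  calc _ ≤ s ^ (m : ℝ) * (|Real.log s| + |θ|) ^ j *
        (C * Real.exp (c / 2) * Real.exp (-(c / 2) * s ^ a)) * 1 := by gcongr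
    _ = _ := by ring

theorem neg_half_lt_natCast (m : ℕ) : -1 / 2 < (m : ℝ) := by
  have : (0 : ℝ) ≤ m := m.cast_nonneg
  linarith

theorem integrableOn_rayFn {θ x α : ℝ} (m j : ℕ) (hα : 0 < α) (hcos : 0 < Real.cos (α * θ))
    (hx : 0 ≤ x * Real.sin θ) : IntegrableOn (rayFn θ m j x α) (Set.Ioi 0) := by
  obtain ⟨C, -, h⟩ := exists_norm_rayFn_le j hcos
  exact Integrable.mono' ((integrableOn_majorant θ (neg_half_lt_natCast m) j (half_pos hcos)
    hα).const_mul C) (measurable_rayFn θ m j x α).aestronglyMeasurable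
    (ae_Ioi fun s hs => h θ m x α α s hα le_rfl le_rfl hx hs)

theorem hasDerivAt_rayInt_exponent {θ x α : ℝ} (m j : ℕ) (hα : 0 < α)
    (hcos : 0 < Real.cos (α * θ)) (hx : 0 ≤ x * Real.sin θ) :
    HasDerivAt (rayInt θ m j x) (rayInt θ m (j + 1) x α) α := by
  obtain ⟨C, -, h⟩ := exists_norm_rayFn_le (j + 1) (half_pos hcos)
  have hU : {a : ℝ | α / 2 < a ∧ Real.cos (α * θ) / 2 < Real.cos (a * θ)} ∈ 𝓝 α := by
    refine (IsOpen.inter (isOpen_lt continuous_const continuous_id)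
      (isOpen_lt continuous_const
        (show Continuous fun a : ℝ => Real.cos (a * θ) by fun_prop))).mem_nhds ⟨?_, ?_⟩
    · exact half_lt_self hα
    · exact half_lt_self hcos
  refine (hasDerivAt_integral_of_dominated_loc_of_deriv_le
    (F := fun a s => rayFn θ m j x a s) (F' := fun a s => rayFn θ m (j + 1) x a s)
    (bound := fun s => C * majorant θ m (j + 1) (Real.cos (α * θ) / 2 / 2) (α / 2) s) hU
    (Eventually.of_forall fun a => (measurable_rayFn θ m j x a).aestronglyMeasurable)
    (integrableOn_rayFn m j hα hcos hx) (measurable_rayFn θ m (j + 1) x α).aestronglyMeasurable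
    (ae_Ioi fun s hs a ha => h θ m x a (α / 2) s (half_pos hα) ha.1.le ha.2.le hx hs)
    ((integrableOn_majorant θ (neg_half_lt_natCast m) (j + 1) (half_pos (half_pos hcos))
      (half_pos hα)).const_mul C)
    (Eventually.of_forall fun s a _ => ?_)).2
  refine (((hasDerivAt_eulerExp_exp j (rayLog θ s) a).const_mul _).mul_const _).congr_deriv ?_
  rw [rayFn]
  ring

theorem hasDerivAt_rayInt {θ x α : ℝ} (m j : ℕ) (hα : 0 < α) (hcos : 0 < Real.cos (α * θ))
    (hx : ∀ᶠ y in 𝓝 x, 0 ≤ y * Real.sin θ) :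
    HasDerivAt (fun y => rayInt θ m j y α) (rayInt θ (m + 1) j x α) x := by
  obtain ⟨C, -, h⟩ := exists_norm_rayFn_le j hcos
  refine (hasDerivAt_integral_of_dominated_loc_of_deriv_le
    (F := fun y s => rayFn θ m j y α s) (F' := fun y s => rayFn θ (m + 1) j y α s)
    (bound := fun s => C * majorant θ (m + 1 : ℕ) j (Real.cos (α * θ) / 2) α s) hx
    (Eventually.of_forall fun a => (measurable_rayFn θ m j a α).aestronglyMeasurable)
    (integrableOn_rayFn m j hα hcos hx.self_of_nhds)
    (measurable_rayFn θ (m + 1) j x α).aestronglyMeasurable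
    (ae_Ioi fun s hs y hy => h θ (m + 1) y α α s hα le_rfl le_rfl hy hs)
    ((integrableOn_majorant θ (neg_half_lt_natCast (m + 1)) j (half_pos hcos) hα).const_mul C)
    (Eventually.of_forall fun s y _ => ?_)).2
  have h1 : HasDerivAt (fun y : ℝ => Complex.I * Complex.exp (rayLog θ s) * (y : ℂ))
      (Complex.I * Complex.exp (rayLog θ s)) y := by
    simpa using (Complex.ofRealCLM.hasDerivAt (x := y)).const_mul _
  refine (h1.cexp.const_mul _).congr_deriv ?_
  rw [rayFn]
  ring

/-! ### Moments along a ray and their derivatives in the exponent. -/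

theorem norm_rayMomFn_le (θ : ℝ) (m j : ℕ) (x p : ℝ) {s : ℝ} (hs : 0 < s) :
    ‖rayMomFn θ m j x p s‖ ≤ majorant θ (m + p) j (x * Real.sin θ) 1 s := by
  rw [rayMomFn, norm_mul, norm_mul, norm_mul, norm_mul, Complex.norm_exp_ofReal_mul_I, norm_pow,
    norm_pow, norm_mul, Complex.norm_I, one_mul, one_mul, norm_exp_rayLog hs,
    norm_exp_I_mul_exp_rayLog hs, norm_exp_mul_rayLog hs, majorant, Real.rpow_add hs,
    Real.rpow_natCast, Real.rpow_one]
  calc _ ≤ s ^ m * (|Real.log s| + |θ|) ^ j * s ^ p * Real.exp (-(x * Real.sin θ) * s) := by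
        gcongr
        exact norm_rayLog_le θ s
    _ = _ := by ring

theorem integrableOn_rayMomFn {θ x p : ℝ} (m j : ℕ) (hp : -1 / 2 < p)
    (hx : 0 < x * Real.sin θ) : IntegrableOn (rayMomFn θ m j x p) (Set.Ioi 0) :=
  Integrable.mono' (integrableOn_majorant θ (by linarith [m.cast_nonneg (α := ℝ)]) j hx one_pos)
    (measurable_rayMomFn θ m j x p).aestronglyMeasurable
    (ae_Ioi fun _ hs => norm_rayMomFn_le θ m j x p hs)

theorem rpow_le_rpow_add_rpow {s p p₁ p₂ : ℝ} (hs : 0 < s) (h₁ : p₁ ≤ p) (h₂ : p ≤ p₂) :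
    s ^ p ≤ s ^ p₁ + s ^ p₂ := by
  rcases le_total 1 s with h | h
  · linarith [Real.rpow_le_rpow_of_exponent_le h h₂, Real.rpow_nonneg hs.le p₁]
  · linarith [Real.rpow_le_rpow_of_exponent_ge hs h h₁, Real.rpow_nonneg hs.le p₂]

theorem hasDerivAt_rayMom {θ x p : ℝ} (m j : ℕ) (hp : -1 / 2 < p) (hx : 0 < x * Real.sin θ) :
    HasDerivAt (rayMom θ m j x) (rayMom θ m (j + 1) x p) p := by
  obtain ⟨p₁, h₁, h₁'⟩ := exists_between hp
  have hm := m.cast_nonneg (α := ℝ)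
  refine (hasDerivAt_integral_of_dominated_loc_of_deriv_le
    (F := fun q s => rayMomFn θ m j x q s) (F' := fun q s => rayMomFn θ m (j + 1) x q s)
    -- The exponent ranges over `[p₁, p + 1]`; a power with exponent in an interval is at most the
    -- sum of the powers at its two ends.
    (bound := fun s => majorant θ (m + p₁) (j + 1) (x * Real.sin θ) 1 s +
      majorant θ (m + (p + 1)) (j + 1) (x * Real.sin θ) 1 s) (Icc_mem_nhds h₁' (lt_add_one p))
    (Eventually.of_forall fun a => (measurable_rayMomFn θ m j x a).aestronglyMeasurable)
    (integrableOn_rayMomFn m j hp hx)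
    (measurable_rayMomFn θ m (j + 1) x p).aestronglyMeasurable
    (ae_Ioi fun s hs q hq => (norm_rayMomFn_le θ m (j + 1) x q hs).trans ?_)
    ((integrableOn_majorant θ (by linarith) (j + 1) hx one_pos).add
      (integrableOn_majorant θ (by linarith) (j + 1) hx one_pos))
    (Eventually.of_forall fun s q _ => ?_)).2
  · unfold majorant
    rw [← add_mul, ← add_mul]
    gcongr
    exact rpow_le_rpow_add_rpow hs (by linarith [hq.1]) (by linarith [hq.2])
  · have h1 : HasDerivAt (fun q : ℝ => (q : ℂ) * rayLog θ s) (rayLog θ s) q := by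
      simpa using (Complex.ofRealCLM.hasDerivAt (x := q)).mul_const _
    refine ((h1.cexp.const_mul _).mul_const _).congr_deriv ?_
    rw [rayMomFn]
    ring

/-! ### Rotation of the ray of integration. -/

theorem tendsto_rpow_mul_exp_neg_mul_rpow (q : ℝ) {c a : ℝ} (hc : 0 < c) (ha : 0 < a) :
    Tendsto (fun s : ℝ => s ^ q * Real.exp (-c * s ^ a)) atTop (𝓝 0) := by
  refine ((tendsto_rpow_mul_exp_neg_mul_atTop_nhds_zero (q / a) c hc).comp
    (tendsto_rpow_atTop ha)).congr' ?_
  filter_upwards [eventually_gt_atTop 0] with s hs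
  simp only [Function.comp]
  rw [← Real.rpow_mul hs.le, mul_div_cancel₀ _ ha.ne']

theorem hasDerivAt_rayLog (θ : ℝ) {s : ℝ} (hs : 0 < s) :
    HasDerivAt (rayLog θ) (s : ℂ)⁻¹ s := by
  exact ((Real.hasDerivAt_log hs.ne').ofReal_comp.add_const (θ * Complex.I)).congr_deriv
    (by push_cast; rfl)

/-- Rotation of the ray of integration, for an integrand that is a holomorphic function of the
logarithm. -/
theorem integral_ray_eq {Φ Φ' : ℂ → ℂ} (hΦ : ∀ z, HasDerivAt Φ (Φ' z) z) (hΦ' : Continuous Φ')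
    {θ₀ θ₁ q c a : ℝ} (hθ : θ₀ < θ₁) (hq : 0 ≤ q) (hc : 0 < c) (ha : 0 < a) {g : ℝ → ℝ}
    (hg : IntegrableOn g (Set.Ioi 0))
    (hb : ∀ θ ∈ Set.Icc θ₀ θ₁, ∀ s, 0 < s → ‖Φ (rayLog θ s)‖ ≤ majorant 0 q 0 c a s)
    (hb' : ∀ θ ∈ Set.Icc θ₀ θ₁, ∀ s, 0 < s → ‖Φ' (rayLog θ s)‖ ≤ g s) :
    ∫ s in Set.Ioi (0 : ℝ), Complex.exp (θ₀ * Complex.I) * Φ (rayLog θ₀ s) =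
      ∫ s in Set.Ioi (0 : ℝ), Complex.exp (θ₁ * Complex.I) * Φ (rayLog θ₁ s) := by
  set F : ℝ → ℝ → ℂ := fun θ s => Complex.exp (θ * Complex.I) * Φ (rayLog θ s) with hF
  set F' : ℝ → ℝ → ℂ := fun θ s =>
    Complex.I * Complex.exp (θ * Complex.I) * (Φ (rayLog θ s) + Φ' (rayLog θ s)) with hF'
  have hΦc : Continuous Φ := continuous_iff_continuousAt.2 fun z => (hΦ z).continuousAt
  have hmaj := integrableOn_majorant 0 (show -1 / 2 < q by linarith) 0 hc ha
  have hFm : ∀ θ, AEStronglyMeasurable (F θ) (volume.restrict (Set.Ioi 0)) := fun θ => by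
    have h1 := measurable_rayLog θ
    have h2 := hΦc.measurable
    exact Measurable.aestronglyMeasurable (by fun_prop)
  have hFm' : ∀ θ, AEStronglyMeasurable (F' θ) (volume.restrict (Set.Ioi 0)) := fun θ => by
    have h1 := measurable_rayLog θ
    have h2 := hΦc.measurable
    have h3 := hΦ'.measurable
    exact Measurable.aestronglyMeasurable (by fun_prop)
  have hFb : ∀ θ ∈ Set.Icc θ₀ θ₁, ∀ s, 0 < s → ‖F θ s‖ ≤ majorant 0 q 0 c a s := by
    intro θ hθ s hs
    rw [hF, norm_mul, Complex.norm_exp_ofReal_mul_I, one_mul]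
    exact hb θ hθ s hs
  have hFb' : ∀ θ ∈ Set.Icc θ₀ θ₁, ∀ s, 0 < s → ‖F' θ s‖ ≤ majorant 0 q 0 c a s + g s := by
    intro θ hθ s hs
    rw [hF', norm_mul, norm_mul, Complex.norm_exp_ofReal_mul_I, Complex.norm_I, one_mul, one_mul]
    exact (norm_add_le _ _).trans (add_le_add (hb θ hθ s hs) (hb' θ hθ s hs))
  have hlog : ∀ s θ, HasDerivAt (fun t => rayLog t s) Complex.I θ := fun s θ => by
    simpa [rayLog] using ((Complex.ofRealCLM.hasDerivAt (x := θ)).mul_const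
      Complex.I).const_add (Real.log s : ℂ)
  have hFd : ∀ s θ, HasDerivAt (fun t => F t s) (F' θ s) θ := fun s θ => by
    have h1 : HasDerivAt (fun t : ℝ => (t : ℂ) * Complex.I) Complex.I θ := by
      simpa using (Complex.ofRealCLM.hasDerivAt (x := θ)).mul_const Complex.I
    refine (h1.cexp.mul ((hΦ _).comp θ (hlog s θ))).congr_deriv ?_
    simp only [hF', Function.comp]
    ring
  have hint : ∀ θ ∈ Set.Icc θ₀ θ₁, IntegrableOn (F θ) (Set.Ioi 0) := fun θ hθ =>
    Integrable.mono' hmaj (hFm θ) (ae_Ioi (hFb θ hθ))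
  have hint' : ∀ θ ∈ Set.Icc θ₀ θ₁, IntegrableOn (F' θ) (Set.Ioi 0) := fun θ hθ =>
    Integrable.mono' (hmaj.add hg) (hFm' θ) (ae_Ioi (hFb' θ hθ))
  -- This replaces Cauchy's theorem: by holomorphy, the `θ`-derivative `F'` of the integrand is also
  -- the `s`-derivative of `i s F`, which vanishes at `0` and at infinity.
  have hzero : ∀ θ ∈ Set.Icc θ₀ θ₁, ∫ s in Set.Ioi (0 : ℝ), F' θ s = 0 := by
    intro θ hθ
    have hnorm : ∀ s, 0 < s → ‖Complex.I * s * F θ s‖ ≤ s ^ (q + 1) * Real.exp (-c * s ^ a) := by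
      intro s hs
      rw [norm_mul, norm_mul, Complex.norm_I, one_mul, Complex.norm_real,
        Real.norm_of_nonneg hs.le, Real.rpow_add hs, Real.rpow_one]
      calc _ ≤ s * majorant 0 q 0 c a s := by gcongr; exact hFb θ hθ s hs
        _ = _ := by simp only [majorant, pow_zero]; ring
    have hlim : Tendsto (fun s : ℝ => Complex.I * s * F θ s) atTop (𝓝 0) :=
      squeeze_zero_norm' ((eventually_gt_atTop 0).mono hnorm)
        (tendsto_rpow_mul_exp_neg_mul_rpow (q + 1) hc ha)
    have hcont : ContinuousWithinAt (fun s : ℝ => Complex.I * s * F θ s) (Set.Ici 0) 0 := by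
      rw [ContinuousWithinAt, Complex.ofReal_zero, mul_zero, zero_mul]
      have h0 : Tendsto (fun s : ℝ => s ^ (q + 1)) (𝓝[Set.Ici 0] 0) (𝓝 0) := by
        have := (Real.continuousAt_rpow_const 0 (q + 1) (Or.inr (by linarith))).tendsto
        rw [Real.zero_rpow (by linarith)] at this
        exact this.mono_left nhdsWithin_le_nhds
      refine squeeze_zero_norm' ?_ h0
      filter_upwards [self_mem_nhdsWithin] with s hs
      rcases (Set.mem_Ici.1 hs).eq_or_lt with rfl | hs
      · simp [Real.zero_rpow (show q + 1 ≠ 0 by linarith)]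
      · refine (hnorm s hs).trans (mul_le_of_le_one_right (by positivity) ?_)
        exact Real.exp_le_one_iff.2 (by have := Real.rpow_nonneg hs.le a; nlinarith)
    have := integral_Ioi_of_hasDerivAt_of_tendsto hcont (fun s hs => ?_) (hint' θ hθ) hlim
    · simpa using this
    · have hs : 0 < s := hs
      have hs0 : (s : ℂ) ≠ 0 := Complex.ofReal_ne_zero.2 hs.ne'
      have h1 : HasDerivAt (fun s : ℝ => Complex.I * (s : ℂ)) Complex.I s := by
        simpa using (Complex.ofRealCLM.hasDerivAt (x := s)).const_mul Complex.I
      refine (h1.mul (((hΦ _).comp s (hasDerivAt_rayLog θ hs)).const_mul _)).congr_deriv ?_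
      simp only [hF', Function.comp]
      field_simp
  have hderiv : ∀ θ ∈ Set.Ioo θ₀ θ₁,
      HasDerivAt (fun t => ∫ s in Set.Ioi (0 : ℝ), F t s) 0 θ := by
    intro θ hθ
    have := (hasDerivAt_integral_of_dominated_loc_of_deriv_le (F := F) (F' := F')
      (Icc_mem_nhds hθ.1 hθ.2) (Eventually.of_forall hFm)
      (hint θ (Set.Ioo_subset_Icc_self hθ)) (hFm' θ) (ae_Ioi fun s hs t ht => hFb' t ht s hs)
      (hmaj.add hg) (Eventually.of_forall fun s t _ => hFd s t)).2
    rwa [hzero θ (Set.Ioo_subset_Icc_self hθ)] at this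
  have hcontOn : ContinuousOn (fun t => ∫ s in Set.Ioi (0 : ℝ), F t s) (Set.Icc θ₀ θ₁) :=
    continuousOn_of_dominated (fun t _ => hFm t) (fun t ht => ae_Ioi (hFb t ht)) hmaj
      (Eventually.of_forall fun s t _ => (hFd s t).continuousAt.continuousWithinAt)
  refine (constant_of_has_deriv_right_zero hcontOn (fun t ht => ?_) θ₁
    (Set.right_mem_Icc.2 hθ.le)).symm
  -- At the left endpoint the right derivative is obtained as the limit of the interior derivatives,
  -- which are all zero.
  rcases ht.1.eq_or_lt with rfl | h
  · refine hasDerivWithinAt_Ici_of_tendsto_deriv (s := Set.Ioo θ₀ θ₁)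
      (fun u hu => (hderiv u hu).differentiableAt.differentiableWithinAt)
      ((hcontOn _ (Set.left_mem_Icc.2 hθ.le)).mono Set.Ioo_subset_Icc_self)
      (Ioo_mem_nhdsGT hθ) (tendsto_const_nhds.congr' ?_)
    filter_upwards [Ioo_mem_nhdsGT hθ] with u hu
    exact (hderiv u hu).deriv.symm
  · exact (hderiv t ⟨h, ht.2⟩).hasDerivWithinAt

/-! ### The density as a ray integral, and its rotation to the angle `π/6`. -/

theorem density_eq {α : ℝ} (hα : 0 < α) (x : ℝ) :
    density x α = 1 / Real.pi * (rayInt 0 0 0 x α).re := by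
  have h1 : ∫ t : ℝ, Real.cos (t * x) * charFn α t =
      2 * ∫ s in Set.Ioi (0 : ℝ), Real.cos (s * x) * Real.exp (-s ^ α) := by
    rw [← integral_comp_abs]
    refine integral_congr_ae (Eventually.of_forall fun t => ?_)
    simp only [charFn]
    rcases abs_choice t with h | h <;> rw [h]
    rw [neg_mul, Real.cos_neg]
  have h2 := Complex.reCLM.integral_comp_comm
    (integrableOn_rayFn 0 0 (x := x) (θ := 0) hα (by simp) (by simp))
  have h3 : (rayInt 0 0 0 x α).re =
      ∫ s in Set.Ioi (0 : ℝ), Real.cos (s * x) * Real.exp (-s ^ α) := by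
    rw [rayInt, ← Complex.reCLM_apply, ← h2]
    refine setIntegral_congr_fun measurableSet_Ioi fun s hs => ?_
    have hs : 0 < s := hs
    simp only [Complex.reCLM_apply, rayFn, eulerExp, eulerPoly, exp_rayLog hs, exp_mul_rayLog hs]
    simp only [Complex.ofReal_zero, zero_mul, Complex.exp_zero, mul_zero, pow_zero, mul_one,
      one_mul, Polynomial.eval_one]
    rw [← Complex.ofReal_neg, ← Complex.ofReal_exp, Complex.re_ofReal_mul,
      show Complex.I * s * x = ((s * x : ℝ) : ℂ) * Complex.I by push_cast; ring,
      Complex.exp_ofReal_mul_I_re, mul_comm]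
  rw [density, h1, h3]
  ring

/-- The bound `3` exceeds `2`, so the angle `π/6` serves on an open neighbourhood of `α = 2` and
ordinary derivatives in `α` can be compared there. -/
theorem cos_mul_pi_div_six_pos {α : ℝ} (h0 : 0 < α) (h3 : α < 3) :
    0 < Real.cos (α * (Real.pi / 6)) :=
  Real.cos_pos_of_mem_Ioo ⟨by nlinarith [Real.pi_pos], by nlinarith [Real.pi_pos]⟩

theorem sin_pi_div_six_mul_pos {x : ℝ} (hx : 0 < x) : 0 < x * Real.sin (Real.pi / 6) := by
  rw [Real.sin_pi_div_six]
  linarith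

theorem rayInt_zero_eq {x α : ℝ} (hx : 0 < x) (h0 : 0 < α) (h3 : α < 3) :
    rayInt 0 0 0 x α = rayInt (Real.pi / 6) 0 0 x α := by
  have hpi := Real.pi_pos
  have hc := cos_mul_pi_div_six_pos h0 h3
  set c := Real.cos (α * (Real.pi / 6)) with hcdef
  set Φ : ℂ → ℂ := fun z => Complex.exp (Complex.I * Complex.exp z * x - Complex.exp (α * z))
    with hΦdef
  set Φ' : ℂ → ℂ := fun z => Φ z * (Complex.I * Complex.exp z * x - Complex.exp (α * z) * α)
    with hΦ'def
  have hd : ∀ z, HasDerivAt Φ (Φ' z) z := fun z => by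
    have h1 := ((Complex.hasDerivAt_exp z).const_mul Complex.I).mul_const (x : ℂ)
    have h2 := ((hasDerivAt_id z).const_mul (α : ℂ)).cexp
    simpa [hΦ'def, hΦdef] using (h1.sub h2).cexp
  have hΦ'c : Continuous Φ' := by
    simp only [hΦ'def, hΦdef]
    fun_prop
  have hb : ∀ θ ∈ Set.Icc 0 (Real.pi / 6), ∀ s, 0 < s →
      ‖Φ (rayLog θ s)‖ ≤ majorant 0 0 0 c α s := by
    intro θ hθ s hs
    rw [hΦdef]
    simp only [sub_eq_add_neg, Complex.exp_add, norm_mul]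
    rw [norm_exp_I_mul_exp_rayLog hs, Complex.norm_exp, Complex.neg_re, re_exp_mul_rayLog hs,
      majorant, Real.rpow_zero, pow_zero, one_mul, one_mul]
    -- The cosine decreases on `[0, π]`, so the decay of `exp(-z^α)` is weakest at the final angle.
    have h1 : c ≤ Real.cos (α * θ) := by
      refine Real.cos_le_cos_of_nonneg_of_le_pi (mul_nonneg h0.le hθ.1) ?_ ?_
      · nlinarith
      · gcongr
        exact hθ.2
    have h2 : 0 ≤ Real.sin θ := Real.sin_nonneg_of_nonneg_of_le_pi hθ.1 (by linarith [hθ.2])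
    calc _ ≤ 1 * Real.exp (-c * s ^ α) := by
          gcongr
          · exact Real.exp_le_one_iff.2 (by rw [neg_mul]; exact neg_nonpos.2 (by positivity))
          · rw [neg_mul, mul_comm c]
            gcongr
      _ = _ := one_mul _
  have hrot := integral_ray_eq hd hΦ'c (θ₀ := 0) (θ₁ := Real.pi / 6) (q := 0) (c := c) (a := α)
    (g := fun s => x * majorant 0 1 0 c α s + α * majorant 0 α 0 c α s) (by positivity) le_rfl hc
    h0 (((integrableOn_majorant 0 (by norm_num) 0 hc h0).const_mul x).add
      ((integrableOn_majorant 0 (by linarith) 0 hc h0).const_mul α)) hb ?_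
  · have key : ∀ θ : ℝ, ∫ s in Set.Ioi (0 : ℝ), Complex.exp (θ * Complex.I) * Φ (rayLog θ s) =
        rayInt θ 0 0 x α := by
      intro θ
      rw [rayInt]
      congr 1 with s
      simp only [rayFn, hΦdef, eulerExp, eulerPoly, pow_zero, mul_one, Polynomial.eval_one, one_mul,
        sub_eq_add_neg, Complex.exp_add]
      ring
    rw [← key, ← key]
    exact hrot
  · intro θ hθ s hs
    simp only [hΦ'def]
    rw [norm_mul]
    have h1 : ‖Complex.I * Complex.exp (rayLog θ s) * x - Complex.exp (α * rayLog θ s) * α‖ ≤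
        s * x + s ^ α * α := by
      refine (norm_sub_le _ _).trans (le_of_eq ?_)
      rw [norm_mul, norm_mul, norm_mul, Complex.norm_I, norm_exp_rayLog hs, norm_exp_mul_rayLog hs,
        Complex.norm_real, Complex.norm_real, Real.norm_of_nonneg hx.le, Real.norm_of_nonneg h0.le,
        one_mul]
    calc _ ≤ majorant 0 0 0 c α s * (s * x + s ^ α * α) := by
          gcongr
          · exact majorant_nonneg _ _ _ _ _ hs
          · exact hb θ hθ s hs
      _ = _ := by
          simp only [majorant, pow_zero, Real.rpow_zero, Real.rpow_one]
          ring

/-- Only `m = j = 0` needs a contour argument. The other cases follow by differentiating that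
identity on the open set of parameters `x > 0`, `0 < α < 3` and using uniqueness of derivatives. -/
theorem rayInt_eq {x α : ℝ} (m j : ℕ) (hx : 0 < x) (h0 : 0 < α) (h3 : α < 3) :
    rayInt 0 m j x α = rayInt (Real.pi / 6) m j x α := by
  induction m generalizing x with
  | zero =>
    induction j generalizing α with
    | zero => exact rayInt_zero_eq hx h0 h3
    | succ j ih =>
      have h1 := hasDerivAt_rayInt_exponent 0 j (θ := 0) (x := x) h0 (by simp) (by simp)
      have h2 := hasDerivAt_rayInt_exponent 0 j (θ := Real.pi / 6) (x := x) h0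
        (cos_mul_pi_div_six_pos h0 h3) (sin_pi_div_six_mul_pos hx).le
      refine h1.unique (h2.congr_of_eventuallyEq ?_)
      filter_upwards [Ioo_mem_nhds h0 h3] with a ha using ih ha.1 ha.2
  | succ m ih =>
    have h1 := hasDerivAt_rayInt m j (θ := 0) (x := x) h0 (by simp) (by simp)
    have h2 := hasDerivAt_rayInt m j (θ := Real.pi / 6) (x := x) h0 (cos_mul_pi_div_six_pos h0 h3)
      ((eventually_gt_nhds hx).mono fun y hy => (sin_pi_div_six_mul_pos hy).le)
    refine h1.unique (h2.congr_of_eventuallyEq ?_)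
    filter_upwards [eventually_gt_nhds hx] with y hy using ih hy

/-! ### Evaluation of the moments by the Gamma function. -/

/-- On the imaginary axis `exp(izx)` is `exp(-xs)` and the moment is a Gamma integral. With no
factor `exp(-z^α)` left, the ray may be turned up to `π/2`; `sin θ ≥ 1/2` on the way keeps the decay
uniform. -/
theorem rayMom_zero_zero {x p : ℝ} (hx : 0 < x) (hp : 0 ≤ p) :
    rayMom (Real.pi / 6) 0 0 x p = Complex.I * Complex.exp ((p * (Real.pi / 2) : ℝ) * Complex.I) *
      (x ^ (-p - 1) * Real.Gamma (p + 1) : ℝ) := by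
  have hpi := Real.pi_pos
  set Φ : ℂ → ℂ := fun z => Complex.exp (p * z + Complex.I * Complex.exp z * x) with hΦdef
  set Φ' : ℂ → ℂ := fun z => Φ z * (p + Complex.I * Complex.exp z * x) with hΦ'def
  have hd : ∀ z, HasDerivAt Φ (Φ' z) z := fun z => by
    have h1 := ((Complex.hasDerivAt_exp z).const_mul Complex.I).mul_const (x : ℂ)
    have h2 := (hasDerivAt_id z).const_mul (p : ℂ)
    simpa [hΦ'def, hΦdef] using (h2.add h1).cexp
  have hΦ'c : Continuous Φ' := by
    simp only [hΦ'def, hΦdef]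
    fun_prop
  have hb : ∀ θ ∈ Set.Icc (Real.pi / 6) (Real.pi / 2), ∀ s, 0 < s →
      ‖Φ (rayLog θ s)‖ ≤ majorant 0 p 0 (x / 2) 1 s := by
    intro θ hθ s hs
    rw [hΦdef]
    simp only [Complex.exp_add, norm_mul]
    rw [norm_exp_I_mul_exp_rayLog hs, norm_exp_mul_rayLog hs, majorant, pow_zero, mul_one,
      Real.rpow_one]
    have h1 : 1 / 2 ≤ Real.sin θ := by
      rw [← Real.sin_pi_div_six]
      exact Real.sin_le_sin_of_le_of_le_pi_div_two (by linarith) hθ.2 hθ.1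
    gcongr
    nlinarith
  have hrot := integral_ray_eq hd hΦ'c (θ₀ := Real.pi / 6) (θ₁ := Real.pi / 2) (q := p)
    (c := x / 2) (a := 1)
    (g := fun s => p * majorant 0 p 0 (x / 2) 1 s + x * majorant 0 (p + 1) 0 (x / 2) 1 s)
    (by linarith) hp (half_pos hx)
    one_pos (((integrableOn_majorant 0 (by linarith) 0 (half_pos hx) one_pos).const_mul p).add
      ((integrableOn_majorant 0 (by linarith) 0 (half_pos hx) one_pos).const_mul x)) hb ?_
  · have key : ∫ s in Set.Ioi (0 : ℝ),
        Complex.exp ((Real.pi / 6 : ℝ) * Complex.I) * Φ (rayLog (Real.pi / 6) s) =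
        rayMom (Real.pi / 6) 0 0 x p := by
      rw [rayMom]
      congr 1 with s
      simp only [rayMomFn, hΦdef, pow_zero, mul_one, Complex.exp_add]
      ring
    rw [← key, hrot]
    have h2 := Real.integral_rpow_mul_exp_neg_mul_Ioi (a := p + 1) (r := x) (by linarith) hx
    have h3 : (1 / x) ^ (p + 1) = x ^ (-p - 1) := by
      rw [one_div, Real.inv_rpow hx.le, ← Real.rpow_neg hx.le]
      congr 1
      ring
    rw [← h3, ← h2, ← integral_complex_ofReal, ← integral_const_mul]
    refine setIntegral_congr_fun measurableSet_Ioi fun s hs => ?_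
    have hs : 0 < s := hs
    have h4 : Complex.exp ((Real.pi / 2 : ℝ) * Complex.I) = Complex.I := by
      push_cast
      exact Complex.exp_pi_div_two_mul_I
    simp only [hΦdef]
    rw [Complex.exp_add, exp_mul_rayLog hs, exp_rayLog hs, h4, add_sub_cancel_right,
      show Complex.I * (s * Complex.I) * x = (-(x * s) : ℝ) by
        push_cast
        linear_combination (s : ℂ) * x * Complex.I_mul_I,
      Complex.ofReal_mul (s ^ p), Complex.ofReal_exp]
    ring
  · intro θ hθ s hs
    simp only [hΦ'def]
    rw [norm_mul]
    have h1 : ‖(p : ℂ) + Complex.I * Complex.exp (rayLog θ s) * x‖ ≤ p + s * x := by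
      refine (norm_add_le _ _).trans (le_of_eq ?_)
      rw [norm_mul, norm_mul, Complex.norm_I, norm_exp_rayLog hs, Complex.norm_real,
        Complex.norm_real, Real.norm_of_nonneg hx.le, Real.norm_of_nonneg hp, one_mul]
    calc _ ≤ majorant 0 p 0 (x / 2) 1 s * (p + s * x) := by
          gcongr
          · exact majorant_nonneg _ _ _ _ _ hs
          · exact hb θ hθ s hs
      _ = _ := by
          simp only [majorant, pow_zero, Real.rpow_one, Real.rpow_add hs]
          ring

theorem rayMom_eq_I_pow_mul (θ : ℝ) (m : ℕ) (x p : ℝ) :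
    rayMom θ m 0 x p = Complex.I ^ m * rayMom θ 0 0 x (p + m) := by
  rw [rayMom, rayMom, ← integral_const_mul]
  congr 1 with s
  simp only [rayMomFn, pow_zero, mul_one, mul_pow, ← Complex.exp_nat_mul, Complex.ofReal_add,
    Complex.ofReal_natCast, add_mul, Complex.exp_add]
  ring

theorem re_rayMom {x p : ℝ} (m : ℕ) (hx : 0 < x) (hp : 0 ≤ p) :
    (rayMom (Real.pi / 6) m 0 x p).re =
      (-1) ^ (m + 1) * Real.sin (Real.pi * p / 2) *
        (x ^ (-p - m - 1) * Real.Gamma (p + m + 1)) := by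
  have h : Complex.exp (((p + m) * (Real.pi / 2) : ℝ) * Complex.I) =
      Complex.I ^ m * Complex.exp ((Real.pi * p / 2 : ℝ) * Complex.I) := by
    nth_rw 2 [← Complex.exp_pi_div_two_mul_I]
    rw [← Complex.exp_nat_mul, ← Complex.exp_add]
    congr 1
    push_cast
    ring
  rw [rayMom_eq_I_pow_mul, rayMom_zero_zero hx (by positivity), h,
    -- One factor `I ^ m` comes from `(iz)^m`, the other from the phase at the exponent `p + m`;
    -- together they give `(-1)^m`.
    show ∀ a b c : ℂ, a ^ m * (Complex.I * (a ^ m * b) * c) = (a * a) ^ m * (Complex.I * b) * c from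
      fun a b c => by rw [mul_pow]; ring, Complex.I_mul_I,
    show ((-1 : ℂ)) ^ m = (((-1 : ℝ) ^ m : ℝ) : ℂ) by push_cast; rfl, Complex.re_mul_ofReal,
    Complex.re_ofReal_mul, Complex.I_mul_re, Complex.exp_ofReal_mul_I_im,
    show -(p + m) - 1 = -p - m - 1 by ring]
  ring

/-! ### Smoothness of the density and its derivatives as ray integrals. -/

theorem differentiableOn_deriv_Gamma :
    DifferentiableOn ℝ (deriv Real.Gamma) (Set.Ioi 0) := by
  have h1 : AnalyticOnNhd ℂ Complex.Gamma {z | 0 < z.re} := by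
    refine DifferentiableOn.analyticOnNhd (fun z hz => ?_) (isOpen_lt continuous_const
      Complex.continuous_re)
    refine (Complex.differentiableAt_Gamma z fun n h => ?_).differentiableWithinAt
    have hz : 0 < z.re := hz
    rw [h] at hz
    simp only [Complex.neg_re, Complex.natCast_re] at hz
    linarith [n.cast_nonneg (α := ℝ)]
  intro s hs
  have hs : 0 < s := hs
  have h2 : ContDiffAt ℝ 2 Real.Gamma s := by
    have h3 : ContDiffAt ℂ 2 Complex.Gamma s := (h1 s (by simpa using hs)).contDiffAt
    have h4 := h3.real_of_complex
    refine h4.congr_of_eventuallyEq (Eventually.of_forall fun t => ?_)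
    simp [Complex.Gamma_ofReal]
  have h5 : ContDiffAt ℝ 1 (deriv Real.Gamma) s := h2.derivWithin (by norm_num)
  exact (h5.differentiableAt (by norm_num)).differentiableWithinAt

theorem HasDerivAt.complex_re {f : ℝ → ℂ} {f' : ℂ} {x : ℝ} (h : HasDerivAt f f' x) :
    HasDerivAt (fun y => (f y).re) f'.re x :=
  Complex.reCLM.hasFDerivAt.comp_hasDerivAt x h

/-- Used with `f j` the real part of `rayInt`, where `j` counts derivatives in `x` or in `α`. -/
theorem contDiffOn_of_hasDerivAt_seq {f : ℕ → ℝ → ℝ} {s : Set ℝ} (hs : IsOpen s)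
    (h : ∀ j, ∀ x ∈ s, HasDerivAt (f j) (f (j + 1) x) x) (n j : ℕ) : ContDiffOn ℝ n (f j) s := by
  induction n generalizing j with
  | zero =>
    exact contDiffOn_zero.2 fun x hx => (h j x hx).continuousAt.continuousWithinAt
  | succ n ih =>
    push_cast
    refine (contDiffOn_succ_iff_deriv_of_isOpen hs).2
      ⟨fun x hx => (h j x hx).differentiableAt.differentiableWithinAt, by simp, ?_⟩
    exact (ih (j + 1)).congr fun x hx => (h j x hx).deriv

theorem hasDerivAt_re_rayInt {α : ℝ} (hα : 0 < α) (m j : ℕ) (x : ℝ) :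
    HasDerivAt (fun y => 1 / Real.pi * (rayInt 0 m j y α).re)
      (1 / Real.pi * (rayInt 0 (m + 1) j x α).re) x :=
  (HasDerivAt.complex_re (hasDerivAt_rayInt m j hα (by simp) (by simp))).const_mul _

theorem hasDerivAt_re_rayInt_exponent {α : ℝ} (hα : 0 < α) (m j : ℕ) (x : ℝ) :
    HasDerivAt (fun a => 1 / Real.pi * (rayInt 0 m j x a).re)
      (1 / Real.pi * (rayInt 0 m (j + 1) x α).re) α :=
  (HasDerivAt.complex_re (hasDerivAt_rayInt_exponent m j hα (by simp) (by simp))).const_mul _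

theorem contDiff_density {α : ℝ} (hα : 0 < α) : ContDiff ℝ 2 fun x => density x α := by
  simp only [density_eq hα]
  rw [← contDiffOn_univ]
  exact_mod_cast contDiffOn_of_hasDerivAt_seq
    (f := fun m x => 1 / Real.pi * (rayInt 0 m 0 x α).re) isOpen_univ
    (fun m x _ => hasDerivAt_re_rayInt hα m 0 x) 2 0

theorem contDiffOn_density (x : ℝ) : ContDiffOn ℝ 2 (fun α => density x α) (Set.Ioc 0 2) := by
  have h := contDiffOn_of_hasDerivAt_seq
    (f := fun j a => 1 / Real.pi * (rayInt 0 0 j x a).re) isOpen_Ioi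
    (fun j a ha => hasDerivAt_re_rayInt_exponent (Set.mem_Ioi.1 ha) 0 j x) 2 0
  exact (h.mono Set.Ioc_subset_Ioi_self).congr fun a ha => density_eq ha.1 x

theorem densityX_eq {α : ℝ} (hα : 0 < α) (x : ℝ) :
    densityX x α = 1 / Real.pi * (rayInt 0 1 0 x α).re := by
  unfold densityX
  simp only [density_eq hα]
  exact (hasDerivAt_re_rayInt hα 0 0 x).deriv

theorem densityXX_eq {α : ℝ} (hα : 0 < α) (x : ℝ) :
    densityXX x α = 1 / Real.pi * (rayInt 0 2 0 x α).re := by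
  rw [densityXX, iteratedDeriv_succ, iteratedDeriv_one,
    show deriv (fun y => density y α) = fun y => 1 / Real.pi * (rayInt 0 1 0 y α).re from
      funext fun y => densityX_eq hα y]
  exact (hasDerivAt_re_rayInt hα 1 0 x).deriv

theorem densityA_eq {α : ℝ} (h0 : 0 < α) (h2 : α ≤ 2) (x : ℝ) :
    densityA x α = 1 / Real.pi * (rayInt 0 0 1 x α).re := by
  have h : Set.EqOn (fun a => density x a) (fun a => 1 / Real.pi * (rayInt 0 0 0 x a).re)
    (Set.Ioc 0 2) := fun a ha => density_eq ha.1 x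
  rw [densityA, derivWithin_congr h (h ⟨h0, h2⟩)]
  exact (hasDerivAt_re_rayInt_exponent h0 0 0 x).hasDerivWithinAt.derivWithin
    (uniqueDiffOn_Ioc 0 2 α ⟨h0, h2⟩)

theorem densityAA_eq {α : ℝ} (h0 : 0 < α) (h2 : α ≤ 2) (x : ℝ) :
    densityAA x α = 1 / Real.pi * (rayInt 0 0 2 x α).re := by
  have h : Set.EqOn (derivWithin (fun a => density x a) (Set.Ioc 0 2))
    (fun a => 1 / Real.pi * (rayInt 0 0 1 x a).re) (Set.Ioc 0 2) :=
    fun a ha => densityA_eq ha.1 ha.2 x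
  rw [densityAA, iteratedDerivWithin_succ, iteratedDerivWithin_one,
    derivWithin_congr h (h ⟨h0, h2⟩)]
  exact (hasDerivAt_re_rayInt_exponent h0 0 1 x).hasDerivWithinAt.derivWithin
    (uniqueDiffOn_Ioc 0 2 α ⟨h0, h2⟩)

/-! ### Taylor coefficients at `x = 0`. -/

/-- The integral is `Γ((n+1)/α)/α`. Absorbing `1/α` into the argument leaves `α` only inside `Γ`, so
each later derivative in `α` is a plain chain rule. -/
theorem re_rayInt_origin {α : ℝ} (hα : 0 < α) (n : ℕ) :
    (rayInt 0 n 0 0 α).re = (Complex.I ^ n).re * (1 / (n + 1) * Real.Gamma ((n + 1) / α + 1)) := by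
  have h1 : Real.Gamma ((n + 1) / α + 1) = (n + 1) / α * Real.Gamma ((n + 1) / α) :=
    Real.Gamma_add_one (by positivity)
  have h2 : 1 / ((n : ℝ) + 1) * Real.Gamma ((n + 1) / α + 1) =
      ∫ s in Set.Ioi (0 : ℝ), s ^ (n : ℝ) * Real.exp (-s ^ α) := by
    rw [integral_rpow_mul_exp_neg_rpow hα (by linarith [n.cast_nonneg (α := ℝ)]), h1]
    field_simp
  have h3 : rayInt 0 n 0 0 α =
      Complex.I ^ n * ((∫ s in Set.Ioi (0 : ℝ), s ^ (n : ℝ) * Real.exp (-s ^ α) : ℝ) : ℂ) := by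
    rw [rayInt, ← integral_complex_ofReal, ← integral_const_mul]
    refine setIntegral_congr_fun measurableSet_Ioi fun s hs => ?_
    have hs : 0 < s := hs
    simp only [rayFn, eulerExp, eulerPoly, exp_rayLog hs, exp_mul_rayLog hs]
    simp only [Complex.ofReal_zero, zero_mul, Complex.exp_zero, mul_zero, pow_zero, mul_one,
      one_mul, Polynomial.eval_one, Real.rpow_natCast, mul_pow]
    push_cast
    ring
  rw [h3, h2, Complex.re_mul_ofReal]

theorem hasDerivAt_Gamma {s : ℝ} (hs : 0 < s) :
    HasDerivAt Real.Gamma (deriv Real.Gamma s) s :=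
  ((Real.differentiableOn_Gamma_Ioi s hs).differentiableAt (Ioi_mem_nhds hs)).hasDerivAt

theorem hasDerivAt_deriv_Gamma {s : ℝ} (hs : 0 < s) :
    HasDerivAt (deriv Real.Gamma) (iteratedDeriv 2 Real.Gamma s) s := by
  rw [iteratedDeriv_succ, iteratedDeriv_one]
  exact ((differentiableOn_deriv_Gamma s hs).differentiableAt (Ioi_mem_nhds hs)).hasDerivAt

theorem hasDerivAt_div_add_one (b : ℝ) {α : ℝ} (hα : 0 < α) :
    HasDerivAt (fun a : ℝ => b / a + 1) (-b / α ^ 2) α := by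
  have := (((hasDerivAt_const α b).div (hasDerivAt_id α) hα.ne').add_const 1)
  refine this.congr_deriv ?_
  simp

theorem re_rayInt_origin_one {α : ℝ} (hα : 0 < α) (n : ℕ) :
    (rayInt 0 n 1 0 α).re =
      (Complex.I ^ n).re * (-(1 / α ^ 2) * deriv Real.Gamma ((n + 1) / α + 1)) := by
  have h1 := HasDerivAt.complex_re
    (hasDerivAt_rayInt_exponent n 0 (θ := 0) (x := 0) hα (by simp) (by simp))
  have h2 := (((hasDerivAt_Gamma (show 0 < (n + 1 : ℝ) / α + 1 by positivity)).comp α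
    (hasDerivAt_div_add_one (n + 1 : ℝ) hα)).const_mul (1 / (n + 1 : ℝ))).const_mul
    (Complex.I ^ n).re
  refine (h1.unique (h2.congr_of_eventuallyEq ?_)).trans ?_
  · filter_upwards [eventually_gt_nhds hα] with a ha using re_rayInt_origin ha n
  · field_simp

theorem re_rayInt_origin_two {α : ℝ} (hα : 0 < α) (n : ℕ) :
    (rayInt 0 n 2 0 α).re =
      (Complex.I ^ n).re * (2 / α ^ 3 * deriv Real.Gamma ((n + 1) / α + 1) +
        1 / α ^ 4 * (iteratedDeriv 2 Real.Gamma ((n + 1) / α + 1) * (n + 1))) := by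
  have h1 := HasDerivAt.complex_re
    (hasDerivAt_rayInt_exponent n 1 (θ := 0) (x := 0) hα (by simp) (by simp))
  have h2 := (((hasDerivAt_const α (1 : ℝ)).div ((hasDerivAt_id α).pow 2)
    (pow_ne_zero 2 hα.ne')).neg.mul
    ((hasDerivAt_deriv_Gamma (show 0 < (n + 1 : ℝ) / α + 1 by positivity)).comp α
    (hasDerivAt_div_add_one (n + 1 : ℝ) hα))).const_mul (Complex.I ^ n).re
  refine (h1.unique (h2.congr_of_eventuallyEq ?_)).trans ?_
  · filter_upwards [eventually_gt_nhds hα] with a ha using re_rayInt_origin_one ha n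
  · simp only [Function.comp, id, Pi.pow_apply, Pi.neg_apply, Pi.div_apply]
    congr 1
    field_simp
    ring

theorem I_pow_re_two_mul (k : ℕ) : (Complex.I ^ (2 * k)).re = (-1) ^ k := by
  rw [pow_mul, Complex.I_sq, show (-1 : ℂ) ^ k = (((-1) ^ k : ℝ) : ℂ) by push_cast; rfl,
    Complex.ofReal_re]

theorem I_pow_re_of_odd {n : ℕ} (hn : Odd n) : (Complex.I ^ n).re = 0 := by
  obtain ⟨k, rfl⟩ := hn
  rw [pow_succ, pow_mul, Complex.I_sq, show (-1 : ℂ) ^ k = (((-1) ^ k : ℝ) : ℂ) by push_cast; rfl,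
    Complex.re_ofReal_mul, Complex.I_re, mul_zero]

/-! ### Expansion in powers of `x`: convergence and remainder. -/

theorem exists_mul_rpow_le {a b ε : ℝ} (A : ℝ) (hA : 0 ≤ A) (ha : 0 ≤ a) (hab : a < b)
    (hε : 0 < ε) : ∃ K, ∀ s : ℝ, 0 < s → A * s ^ a ≤ ε * s ^ b + K := by
  have hd : 0 < b - a := sub_pos.2 hab
  set s₀ := (A / ε) ^ (b - a)⁻¹ with hs₀
  have h0 : 0 ≤ s₀ := by positivity
  refine ⟨A * s₀ ^ a, fun s hs => ?_⟩
  -- The threshold `s₀` is where `A s^a = ε s^b`; beyond it the higher power wins, below it the left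
  -- side is bounded.
  rcases le_total s₀ s with h | h
  · have h1 : A / ε ≤ s ^ (b - a) := by
      calc A / ε = s₀ ^ (b - a) := by
            rw [hs₀, ← Real.rpow_mul (by positivity), inv_mul_cancel₀ hd.ne', Real.rpow_one]
        _ ≤ _ := by gcongr
    rw [div_le_iff₀ hε] at h1
    have h2 : s ^ b = s ^ (b - a) * s ^ a := by rw [← Real.rpow_add hs, sub_add_cancel]
    have h3 : A * s ^ a ≤ s ^ (b - a) * ε * s ^ a := by gcongr
    have h4 : 0 ≤ A * s₀ ^ a := by positivity
    rw [h2]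
    linarith
  · have h3 : A * s ^ a ≤ A * s₀ ^ a := by gcongr
    have h4 : 0 ≤ ε * s ^ b := by positivity
    linarith

theorem hasSum_pow_div_factorial (t : ℝ) :
    HasSum (fun n : ℕ => t ^ n / n.factorial) (Real.exp t) := by
  rw [Real.exp_eq_exp_ℝ]
  exact NormedSpace.expSeries_div_hasSum_exp t

theorem hasSum_pow_div_factorial_complex (z : ℂ) :
    HasSum (fun n : ℕ => z ^ n / n.factorial) (Complex.exp z) := by
  rw [Complex.exp_eq_exp_ℂ]
  exact NormedSpace.expSeries_div_hasSum_exp z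

theorem rayFn_eq_mul_exp (m j : ℕ) (x α s : ℝ) :
    rayFn 0 m j x α s =
      rayFn 0 m j 0 α s * Complex.exp (Complex.I * Complex.exp (rayLog 0 s) * x) := by
  simp [rayFn]

theorem rayFn_add (m n j : ℕ) (x α s : ℝ) :
    ((x ^ n / n.factorial : ℝ) : ℂ) * rayFn 0 (m + n) j 0 α s =
      rayFn 0 m j 0 α s *
        ((Complex.I * Complex.exp (rayLog 0 s) * x) ^ n / n.factorial) := by
  simp only [rayFn]
  push_cast
  ring

/-- Summing the norms of the terms gives `exp(s|x|)`, and `s|x| ≤ s^α/4 + K` because `α > 1`. The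
integrand at `x = 0` decays at rate `1/2` in `s^α`, so rate `1/4` remains for integrability. -/
theorem hasSum_rayInt_origin {α : ℝ} (hα : 1 < α) (m j : ℕ) (x : ℝ) :
    HasSum (fun n : ℕ => ((x ^ n / n.factorial : ℝ) : ℂ) * rayInt 0 (m + n) j 0 α)
      (rayInt 0 m j x α) := by
  obtain ⟨C, hC, h⟩ := exists_norm_rayFn_le j one_pos
  obtain ⟨K, hK⟩ := exists_mul_rpow_le |x| (abs_nonneg x) zero_le_one hα
    (show (0 : ℝ) < 1 / 4 by norm_num)
  have h0 : 0 < α := by linarith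
  have hb : ∀ s : ℝ, 0 < s → ∀ n : ℕ,
      ‖((x ^ n / n.factorial : ℝ) : ℂ) * rayFn 0 (m + n) j 0 α s‖ =
        ‖rayFn 0 m j 0 α s‖ * ((s * |x|) ^ n / n.factorial) := by
    intro s hs n
    rw [rayFn_add, norm_mul, norm_div, norm_pow, norm_mul, norm_mul, norm_exp_rayLog hs,
      Complex.norm_I, one_mul, Complex.norm_real, Complex.norm_natCast, Real.norm_eq_abs]
  have hsum : ∀ s : ℝ, 0 < s → HasSum
      (fun n : ℕ => ‖((x ^ n / n.factorial : ℝ) : ℂ) * rayFn 0 (m + n) j 0 α s‖)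
      (‖rayFn 0 m j 0 α s‖ * Real.exp (s * |x|)) := by
    intro s hs
    simp only [hb s hs]
    exact (hasSum_pow_div_factorial _).mul_left _
  simp only [rayInt, ← integral_const_mul]
  refine hasSum_integral_of_dominated_convergence
    (fun n s => ‖((x ^ n / n.factorial : ℝ) : ℂ) * rayFn 0 (m + n) j 0 α s‖)
    (fun n => ((measurable_rayFn 0 (m + n) j 0 α).const_mul _).aestronglyMeasurable)
    (fun n => Eventually.of_forall fun s => le_rfl)
    (ae_Ioi fun s hs => (hsum s hs).summable) ?_ (Eventually.of_forall fun s => ?_)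
  · have h1 : Integrable (fun s => ‖rayFn 0 m j 0 α s‖ * Real.exp (s * |x|))
        (volume.restrict (Set.Ioi 0)) := by
      refine Integrable.mono' ((integrableOn_majorant 0 (neg_half_lt_natCast m) j
        (show (0 : ℝ) < 1 / 4 by norm_num) h0).const_mul (C * Real.exp K)) ?_
        (ae_Ioi fun s hs => ?_)
      · have := measurable_rayFn 0 m j 0 α
        exact Measurable.aestronglyMeasurable (by fun_prop)
      · rw [Real.norm_of_nonneg (by positivity)]
        have h2 := h 0 m 0 α α s h0 le_rfl (by simp) (by simp) hs
        have h3 := hK s hs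
        rw [Real.rpow_one] at h3
        calc _ ≤ C * majorant 0 m j (1 / 2) α s * Real.exp (1 / 4 * s ^ α + K) := by
              refine mul_le_mul h2 (Real.exp_le_exp.2 (by linarith)) (Real.exp_nonneg _)
                ((norm_nonneg _).trans h2)
          _ = _ := by
              simp only [majorant]
              rw [show -(1 / 4 : ℝ) * s ^ α = -(1 / 2) * s ^ α + 1 / 4 * s ^ α by ring,
                Real.exp_add, Real.exp_add]
              ring
    exact h1.congr (ae_Ioi fun s hs => (hsum s hs).tsum_eq.symm)
  · simp only [rayFn_add]
    rw [rayFn_eq_mul_exp m j x]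
    exact (hasSum_pow_div_factorial_complex _).mul_left _

/-- Taylor remainder of an entire function, on a set where the function is bounded. -/
theorem exists_norm_sub_sum_le {c : ℕ → ℂ} {h : ℂ → ℂ} {S : Set ℂ} {B : ℝ}
    (hs : ∀ w, HasSum (fun k => c k * w ^ k) (h w)) (hB : ∀ w ∈ S, ‖h w‖ ≤ B) (N : ℕ) :
    ∃ C, ∀ w ∈ S, ‖h w - ∑ k ∈ Finset.range N, c k * w ^ k‖ ≤ C * ‖w‖ ^ N := by
  have hc : Summable fun k => ‖c k‖ := by
    simpa using (hs 1).summable.norm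
  have hsplit := hc.sum_add_tsum_nat_add N
  have hc0 : 0 ≤ ∑ k ∈ Finset.range N, ‖c k‖ := Finset.sum_nonneg fun _ _ => norm_nonneg _
  have hc1 : 0 ≤ ∑' k, ‖c (k + N)‖ := tsum_nonneg fun _ => norm_nonneg _
  refine ⟨|B| + ∑' k, ‖c k‖, fun w hw => ?_⟩
  -- For `‖w‖ ≤ 1` the remainder is the tail of an absolutely convergent series. For `‖w‖ ≥ 1` both
  -- `B` and the partial sum are bounded by multiples of `‖w‖^N`.
  rcases le_total ‖w‖ 1 with h1 | h1
  · have ht := (hasSum_nat_add_iff' N).2 (hs w)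
    have := tsum_of_norm_bounded (((summable_nat_add_iff N).2 hc).hasSum.mul_right (‖w‖ ^ N))
      (f := fun k => c (k + N) * w ^ (k + N)) fun k => by
        rw [norm_mul, norm_pow, pow_add]
        gcongr
        exact mul_le_of_le_one_left (by positivity) (pow_le_one₀ (norm_nonneg w) h1)
    rw [ht.tsum_eq] at this
    refine this.trans ?_
    gcongr
    linarith [abs_nonneg B]
  · have hN : 1 ≤ ‖w‖ ^ N := one_le_pow₀ h1
    calc _ ≤ ‖h w‖ + ∑ k ∈ Finset.range N, ‖c k‖ * ‖w‖ ^ N := by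
          refine (norm_sub_le _ _).trans (add_le_add le_rfl ((norm_sum_le _ _).trans ?_))
          refine Finset.sum_le_sum fun k hk => ?_
          rw [norm_mul, norm_pow]
          gcongr
          exact (Finset.mem_range.1 hk).le
      _ ≤ |B| * ‖w‖ ^ N + (∑' k, ‖c k‖) * ‖w‖ ^ N := by
          rw [← Finset.sum_mul]
          gcongr
          · exact ((hB w hw).trans (le_abs_self B)).trans (le_mul_of_one_le_right (abs_nonneg B) hN)
          · linarith
      _ = _ := by ring

/-- Taylor's remainder is applied to `exp` on the imaginary axis, where it has modulus one;
integrability of `s^N` against the integrand holds for every `α > 0`. -/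
theorem exists_norm_rayInt_sub_le {α : ℝ} (hα : 0 < α) (m j N : ℕ) : ∃ C, ∀ x : ℝ,
    ‖rayInt 0 m j x α - ∑ n ∈ Finset.range N,
      ((x ^ n / n.factorial : ℝ) : ℂ) * rayInt 0 (m + n) j 0 α‖ ≤ C * |x| ^ N := by
  obtain ⟨B, hB⟩ := exists_norm_sub_sum_le (c := fun n => 1 / (n.factorial : ℂ))
    (h := Complex.exp) (S := {w | w.re = 0}) (B := 1)
    (fun w => by simpa [div_eq_inv_mul] using hasSum_pow_div_factorial_complex w)
    (fun w hw => by rw [Complex.norm_exp, show w.re = 0 from hw, Real.exp_zero]) N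
  have hint : ∀ n, IntegrableOn (rayFn 0 n j 0 α) (Set.Ioi 0) := fun n =>
    integrableOn_rayFn n j hα (by simp) (by simp)
  refine ⟨B * ∫ s in Set.Ioi (0 : ℝ), ‖rayFn 0 (m + N) j 0 α s‖, fun x => ?_⟩
  simp only [rayInt, ← integral_const_mul]
  rw [← integral_finsetSum _ fun n _ => (hint (m + n)).const_mul _,
    ← integral_sub (integrableOn_rayFn m j hα (by simp) (by simp))
      (integrable_finsetSum _ fun n _ => (hint (m + n)).const_mul _)]
  rw [mul_comm _ (|x| ^ N), ← integral_const_mul]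
  refine norm_integral_le_of_norm_le (((hint (m + N)).norm.const_mul _).const_mul _) (ae_Ioi fun s hs => ?_)
  have hw := hB (Complex.I * Complex.exp (rayLog 0 s) * x) (by
    rw [exp_rayLog hs]
    simp)
  simp only [rayFn_add]
  rw [rayFn_eq_mul_exp m j x, ← Finset.mul_sum, ← mul_sub, norm_mul]
  have h1 : ‖rayFn 0 (m + N) j 0 α s‖ = ‖rayFn 0 m j 0 α s‖ * s ^ N := by
    simp only [rayFn, norm_mul, pow_add, norm_pow, norm_exp_rayLog hs, Complex.norm_I]
    ring
  rw [norm_mul, norm_mul, Complex.norm_I, norm_exp_rayLog hs, Complex.norm_real,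
    Real.norm_eq_abs, one_mul, mul_pow] at hw
  simp only [one_div_mul_eq_div] at hw
  rw [h1]
  calc _ ≤ ‖rayFn 0 m j 0 α s‖ * (B * (s ^ N * |x| ^ N)) := by gcongr
    _ = _ := by ring

/-! ### Termwise integration at infinity for `α < 1`. -/

/-- The Taylor coefficients of `eulerExp j`. -/
noncomputable def eulerCoeff (j k : ℕ) : ℝ := (-1) ^ k * (k : ℝ) ^ j / k.factorial

theorem hasSum_eulerExp_zero (w : ℂ) :
    HasSum (fun k => (eulerCoeff 0 k : ℂ) * w ^ k) (eulerExp 0 w) := by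
  convert! hasSum_pow_div_factorial_complex (-w) using 1
  · funext k
    rw [eulerCoeff, neg_pow]
    push_cast
    ring
  · simp [eulerExp, eulerPoly]

theorem hasSum_eulerExp_one (w : ℂ) :
    HasSum (fun k => (eulerCoeff 1 k : ℂ) * w ^ k) (eulerExp 1 w) := by
  rw [← hasSum_nat_add_iff' 1]
  convert! (hasSum_eulerExp_zero w).mul_left (-w) using 1
  · funext k
    simp only [eulerCoeff, Nat.factorial_succ]
    push_cast
    have : (k : ℂ) + 1 ≠ 0 := by exact_mod_cast k.succ_ne_zero
    field_simp
    ring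
  · simp [eulerExp, eulerPoly, eulerCoeff]

/-- Rests on `eulerExp 2 w = -w (eulerExp 1 w + eulerExp 0 w)`, matched with the coefficients after
a shift of the index. -/
theorem hasSum_eulerExp_two (w : ℂ) :
    HasSum (fun k => (eulerCoeff 2 k : ℂ) * w ^ k) (eulerExp 2 w) := by
  rw [← hasSum_nat_add_iff' 1]
  convert! ((hasSum_eulerExp_one w).add (hasSum_eulerExp_zero w)).mul_left (-w) using 1
  · funext k
    simp only [eulerCoeff, Nat.factorial_succ]
    push_cast
    have : (k : ℂ) + 1 ≠ 0 := by exact_mod_cast k.succ_ne_zero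
    field_simp
    ring
  · simp [eulerExp, eulerPoly, eulerCoeff]
    ring

theorem hasSum_eulerExp {j : ℕ} (hj : j ≤ 2) (w : ℂ) :
    HasSum (fun k => (eulerCoeff j k : ℂ) * w ^ k) (eulerExp j w) := by
  interval_cases j
  · exact hasSum_eulerExp_zero w
  · exact hasSum_eulerExp_one w
  · exact hasSum_eulerExp_two w

theorem abs_eulerCoeff_le (j k : ℕ) : |eulerCoeff j k| ≤ (2 ^ j) ^ k / k.factorial := by
  rw [eulerCoeff, abs_div, abs_mul, abs_pow, abs_neg, abs_one, one_pow, one_mul, Nat.abs_cast,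
    abs_pow, Nat.abs_cast, ← pow_mul, mul_comm j, pow_mul]
  gcongr
  exact_mod_cast k.lt_two_pow_self.le

theorem rayMomFn_mul (θ : ℝ) (m j k : ℕ) (x α s : ℝ) :
    rayMomFn θ m j x (α * k) s =
      Complex.exp (θ * Complex.I) * (Complex.I * Complex.exp (rayLog θ s)) ^ m *
        rayLog θ s ^ j * Complex.exp (Complex.I * Complex.exp (rayLog θ s) * x) *
        Complex.exp (α * rayLog θ s) ^ k := by
  rw [rayMomFn, ← Complex.exp_nat_mul]
  push_cast
  ring_nf

theorem hasSum_majorant (b : ℝ) (m j : ℕ) (c α r : ℝ) {s : ℝ} (hs : 0 < s) :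
    HasSum (fun k : ℕ => r ^ k / k.factorial * majorant b (m + α * k) j c 1 s)
      (majorant b m j c 1 s * Real.exp (r * s ^ α)) := by
  convert! (hasSum_pow_div_factorial (r * s ^ α)).mul_left (majorant b m j c 1 s) using 1
  funext k
  rw [majorant, majorant, Real.rpow_add hs, Real.rpow_mul hs.le, Real.rpow_natCast, mul_pow,
    Real.rpow_natCast]
  ring

theorem integrable_majorant_mul_exp (b : ℝ) (m j : ℕ) {c α r : ℝ} (hc : 0 < c) (h0 : 0 < α)
    (h1 : α < 1) (hr : 0 ≤ r) :
    IntegrableOn (fun s => majorant b m j c 1 s * Real.exp (r * s ^ α)) (Set.Ioi 0) := by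
  obtain ⟨K, hK⟩ := exists_mul_rpow_le r hr h0.le h1 (half_pos hc)
  refine Integrable.mono' ((integrableOn_majorant b (neg_half_lt_natCast m) j (half_pos hc)
    one_pos).const_mul (Real.exp K)) ?_ (ae_Ioi fun s hs => ?_)
  · unfold majorant
    exact Measurable.aestronglyMeasurable (by fun_prop)
  · have h3 := hK s hs
    have h4 := majorant_nonneg b m j c 1 hs
    rw [Real.rpow_one] at h3
    rw [Real.norm_of_nonneg (by positivity)]
    calc _ ≤ majorant b m j c 1 s * Real.exp (c / 2 * s + K) := by gcongr
      _ = _ := by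
          simp only [majorant, Real.rpow_one]
          rw [show -c * s = -(c / 2) * s + -(c / 2) * s by ring, Real.exp_add, Real.exp_add,
            show Real.exp (c / 2 * s) = (Real.exp (-(c / 2) * s))⁻¹ by
              rw [← Real.exp_neg]; ring_nf]
          field_simp

/-- The majorants of the terms sum to a majorant times `exp(r s^α)`. As `α < 1`, this growth is
absorbed by half of the decay `exp(-x s sin θ)`. -/
theorem hasSum_rayMom_of_le {θ x α r : ℝ} (m j : ℕ) (h0 : 0 < α) (h1 : α < 1) (hr : 0 ≤ r)
    (hx : 0 < x * Real.sin θ) {c : ℕ → ℂ} (hc : ∀ k, ‖c k‖ ≤ r ^ k / k.factorial) {f : ℝ → ℂ}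
    (hf : ∀ s, 0 < s → HasSum (fun k : ℕ => c k * rayMomFn θ m j x (α * k) s) (f s)) :
    HasSum (fun k : ℕ => c k * rayMom θ m j x (α * k)) (∫ s in Set.Ioi (0 : ℝ), f s) := by
  simp only [rayMom, ← integral_const_mul]
  refine hasSum_integral_of_dominated_convergence
    (fun k s => r ^ k / k.factorial * majorant θ (m + α * k) j (x * Real.sin θ) 1 s)
    (fun k => ((measurable_rayMomFn θ m j x (α * k)).const_mul _).aestronglyMeasurable)
    (fun k => ae_Ioi fun s hs => ?_)
    (ae_Ioi fun s hs => (hasSum_majorant θ m j _ α r hs).summable) ?_ (ae_Ioi hf)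
  · rw [norm_mul]
    gcongr
    · exact hc k
    · exact norm_rayMomFn_le θ m j x (α * k) hs
  · exact (integrable_majorant_mul_exp θ m j hx h0 h1 hr).congr
      (ae_Ioi fun s hs => (hasSum_majorant θ m j _ α r hs).tsum_eq.symm)

theorem rayFn_eq (θ : ℝ) (m j : ℕ) (x α s : ℝ) :
    rayFn θ m j x α s =
      Complex.exp (θ * Complex.I) * (Complex.I * Complex.exp (rayLog θ s)) ^ m *
        rayLog θ s ^ j * Complex.exp (Complex.I * Complex.exp (rayLog θ s) * x) *
        eulerExp j (Complex.exp (α * rayLog θ s)) := by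
  rw [rayFn]
  ring

theorem hasSum_rayInt {θ x α : ℝ} (m : ℕ) {j : ℕ} (hj : j ≤ 2) (h0 : 0 < α) (h1 : α < 1)
    (hx : 0 < x * Real.sin θ) :
    HasSum (fun k : ℕ => (eulerCoeff j k : ℂ) * rayMom θ m j x (α * k)) (rayInt θ m j x α) := by
  refine hasSum_rayMom_of_le m j h0 h1 (r := 2 ^ j) (by positivity) hx (fun k => ?_)
    fun s hs => ?_
  · rw [Complex.norm_real, Real.norm_eq_abs]
    exact abs_eulerCoeff_le j k
  · rw [rayFn_eq]
    convert! (hasSum_eulerExp hj (Complex.exp (α * rayLog θ s))).mul_left _ using 1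
    funext k
    rw [rayMomFn_mul]
    ring

/-- Holds for every `r ≥ 0`, so geometric and polynomial factors in `k` can be absorbed when the
series with `Γ'` and `Γ''` are treated separately. -/
theorem summable_norm_rayMom {θ x α r : ℝ} (m j : ℕ) (h0 : 0 < α) (h1 : α < 1) (hr : 0 ≤ r)
    (hx : 0 < x * Real.sin θ) :
    Summable fun k : ℕ => r ^ k / k.factorial * ‖rayMom θ m j x (α * k)‖ := by
  have h := (hasSum_rayMom_of_le m j h0 h1 hr hx (c := fun k => ((r ^ k / k.factorial : ℝ) : ℂ))
    (fun k => by rw [Complex.norm_real, Real.norm_of_nonneg (by positivity)])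
    (fun s hs => Summable.hasSum (Summable.of_norm_bounded (hasSum_majorant θ m j (x * Real.sin θ) α r hs).summable
      fun k => ?_))).summable.norm
  · refine h.congr fun k => ?_
    rw [norm_mul, Complex.norm_real, Real.norm_of_nonneg (by positivity)]
  · rw [norm_mul, Complex.norm_real, Real.norm_of_nonneg (by positivity)]
    gcongr
    exact norm_rayMomFn_le θ m j x (α * k) hs

/-! ### The remainder at infinity. -/

/-- Scaling `s = u/x` produces the power of `x`. -/
theorem exists_integral_majorant_le (b : ℝ) {q : ℝ} (hq : -1 / 2 < q) (j : ℕ) {c : ℝ}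
    (hc : 0 < c) : ∃ C, ∀ x : ℝ, Real.exp 1 ≤ x →
      ∫ s in Set.Ioi (0 : ℝ), majorant b q j (x * c) 1 s ≤
        C * (Real.log x ^ j * x ^ (-q - 1)) := by
  refine ⟨∫ u in Set.Ioi (0 : ℝ), majorant (1 + |b|) q j c 1 u, fun x hx => ?_⟩
  have hx0 : 0 < x := (Real.exp_pos 1).trans_le hx
  have hlog : 1 ≤ Real.log x := (Real.le_log_iff_exp_le hx0).2 hx
  have h1 := integral_comp_mul_left_Ioi (fun u => majorant b q j (x * c) 1 (x⁻¹ * u)) 0 hx0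
  simp only [inv_mul_cancel_left₀ hx0.ne', mul_zero, smul_eq_mul] at h1
  rw [h1]
  have h2 : ∫ u in Set.Ioi (0 : ℝ), majorant b q j (x * c) 1 (x⁻¹ * u) ≤
      ∫ u in Set.Ioi (0 : ℝ), x ^ (-q) * Real.log x ^ j * majorant (1 + |b|) q j c 1 u := by
    refine integral_mono_of_nonneg (ae_Ioi fun u hu => majorant_nonneg _ _ _ _ _ (by positivity))
      ((integrableOn_majorant _ hq j hc one_pos).const_mul _) (ae_Ioi fun u hu => ?_)
    -- Here `log x ≥ 1`, that is `x ≥ e`, lets `log x` be pulled out as a factor; the added `1` in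
    -- `1 + |b|` accounts for the term `log x` itself.
    have h3 : |Real.log (x⁻¹ * u)| + |b| ≤ Real.log x * (|Real.log u| + |1 + abs b|) := by
      rw [Real.log_mul (by positivity) hu.ne', Real.log_inv, abs_of_nonneg (show 0 ≤ 1 + |b| by
        positivity)]
      have h4 : |-Real.log x + Real.log u| ≤ Real.log x + |Real.log u| :=
        (abs_add_le _ _).trans (by rw [abs_neg, abs_of_nonneg (by linarith)])
      nlinarith [abs_nonneg (Real.log u), abs_nonneg b]
    calc majorant b q j (x * c) 1 (x⁻¹ * u)
        ≤ (x⁻¹ * u) ^ q * (Real.log x * (|Real.log u| + |1 + abs b|)) ^ j *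
          Real.exp (-(x * c) * (x⁻¹ * u) ^ (1 : ℝ)) := by
          unfold majorant
          gcongr
      _ = _ := by
          simp only [majorant]
          rw [Real.mul_rpow (by positivity) hu.le, Real.inv_rpow hx0.le, Real.rpow_neg hx0.le,
            mul_pow, Real.rpow_one, Real.rpow_one,
            show -(x * c) * (x⁻¹ * u) = -c * u by field_simp]
          ring
  rw [integral_const_mul] at h2
  calc _ ≤ x⁻¹ * (x ^ (-q) * Real.log x ^ j *
        ∫ u in Set.Ioi (0 : ℝ), majorant (1 + |b|) q j c 1 u) := by gcongr
    _ = _ := by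
        rw [Real.rpow_sub hx0, Real.rpow_one]
        ring

/-- On the ray, `w = z^α` stays in a sector where `eulerExp j` is bounded, so its Taylor remainder
is `O(‖w‖^N)` there. The other factors make the integral of this bound a moment majorant. -/
theorem exists_norm_rayInt_sub_rayMom_le {θ α : ℝ} (m : ℕ) {j : ℕ} (hj : j ≤ 2) (h0 : 0 < α)
    (hcos : 0 < Real.cos (α * θ)) (hsin : 0 < Real.sin θ) (N : ℕ) : ∃ C, ∀ x : ℝ,
      Real.exp 1 ≤ x → ‖rayInt θ m j x α - ∑ k ∈ Finset.range N,
        (eulerCoeff j k : ℂ) * rayMom θ m j x (α * k)‖ ≤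
          C * (Real.log x ^ j * x ^ (-(m + α * N) - 1)) := by
  obtain ⟨B, hB0, hB⟩ := exists_norm_eulerExp_le j hcos
  obtain ⟨D, hD⟩ := exists_norm_sub_sum_le (hasSum_eulerExp hj)
    (S := {w | Real.cos (α * θ) * ‖w‖ ≤ w.re}) (B := B)
    (fun w hw => (hB w hw).trans (mul_le_of_le_one_right hB0 (Real.exp_le_one_iff.2 (by
      have := norm_nonneg w
      nlinarith)))) N
  have hq : -1 / 2 < (m : ℝ) + α * N := by
    have : 0 ≤ (m : ℝ) + α * N := by positivity
    linarith
  obtain ⟨C, hC⟩ := exists_integral_majorant_le θ hq j hsin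
  refine ⟨|D| * C, fun x hx => ?_⟩
  have hx0 : 0 < x := (Real.exp_pos 1).trans_le hx
  have hxs : 0 < x * Real.sin θ := by positivity
  have hint : ∀ k : ℕ, IntegrableOn (rayMomFn θ m j x (α * k)) (Set.Ioi 0) := fun k =>
    integrableOn_rayMomFn m j (by
      have : 0 ≤ α * k := by positivity
      linarith) hxs
  simp only [rayInt, rayMom, ← integral_const_mul]
  rw [← integral_finsetSum _ fun k _ => (hint k).const_mul _,
    ← integral_sub (integrableOn_rayFn m j h0 hcos hxs.le)
      (integrable_finsetSum _ fun k _ => (hint k).const_mul _)]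
  refine (norm_integral_le_of_norm_le ((integrableOn_majorant θ hq j hxs one_pos).const_mul |D|)
    (ae_Ioi fun s hs => ?_)).trans ?_
  · have hw := hD (Complex.exp (α * rayLog θ s)) (by
      rw [Set.mem_ofPred, norm_exp_mul_rayLog hs, re_exp_mul_rayLog hs, mul_comm])
    have h1 := norm_rayMomFn_le θ m j x (α * N) hs
    simp only [rayMomFn_mul] at h1 ⊢
    rw [norm_mul, norm_pow] at h1
    rw [rayFn_eq]
    simp only [mul_left_comm ((eulerCoeff j _ : ℝ) : ℂ)]
    rw [← Finset.mul_sum, ← mul_sub, norm_mul]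
    calc _ ≤ _ * (|D| * ‖Complex.exp (α * rayLog θ s)‖ ^ N) := by
          gcongr
          exact hw.trans (by gcongr; exact le_abs_self D)
      _ = |D| * (_ * ‖Complex.exp (α * rayLog θ s)‖ ^ N) := by ring
      _ ≤ _ := by gcongr
  · rw [integral_const_mul, mul_assoc]
    gcongr
    exact hC x hx

/-! ### Bounds on `Γ`, `Γ'` and `Γ''` by moments at `x = 1`. -/

theorem hasDerivAt_I_mul_exp (p : ℝ) :
    HasDerivAt (fun p : ℝ => Complex.I * Complex.exp ((p * (Real.pi / 2) : ℝ) * Complex.I))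
      (Complex.I * Complex.exp ((p * (Real.pi / 2) : ℝ) * Complex.I) *
        ((Real.pi / 2 : ℝ) * Complex.I)) p := by
  have h := ((((hasDerivAt_id p).mul_const (Real.pi / 2)).ofReal_comp.mul_const
    Complex.I).cexp).const_mul Complex.I
  refine h.congr_deriv ?_
  simp only [id, one_mul]
  ring

/-- At `x = 1` no `log x` appears, and the prefactor is unimodular. The real part of the last factor
isolates `Γ'`, which is thereby bounded by the norm of the moment. -/
theorem rayMom_one_eq {p : ℝ} (hp : 0 < p) :
    rayMom (Real.pi / 6) 0 1 1 p = Complex.I * Complex.exp ((p * (Real.pi / 2) : ℝ) * Complex.I) *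
      (deriv Real.Gamma (p + 1) + Real.Gamma (p + 1) * ((Real.pi / 2 : ℝ) * Complex.I)) := by
  have h1 := hasDerivAt_rayMom 0 0 (θ := Real.pi / 6) (x := 1) (show -1 / 2 < p by linarith)
    (sin_pi_div_six_mul_pos one_pos)
  have h2 := (hasDerivAt_I_mul_exp p).mul
    ((hasDerivAt_Gamma (show 0 < p + 1 by linarith)).comp_add_const p 1).ofReal_comp
  refine (h1.unique (h2.congr_of_eventuallyEq ?_)).trans (by ring)
  filter_upwards [eventually_gt_nhds hp] with q hq
  rw [rayMom_zero_zero one_pos hq.le, Real.one_rpow, one_mul]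
  rfl

theorem rayMom_two_eq {p : ℝ} (hp : 0 < p) :
    rayMom (Real.pi / 6) 0 2 1 p = Complex.I * Complex.exp ((p * (Real.pi / 2) : ℝ) * Complex.I) *
      ((iteratedDeriv 2 Real.Gamma (p + 1) - (Real.pi / 2) ^ 2 * Real.Gamma (p + 1) : ℝ) +
        (Real.pi * deriv Real.Gamma (p + 1) : ℝ) * Complex.I) := by
  have h1 := hasDerivAt_rayMom 0 1 (θ := Real.pi / 6) (x := 1) (show -1 / 2 < p by linarith)
    (sin_pi_div_six_mul_pos one_pos)
  have h2 := (hasDerivAt_I_mul_exp p).mul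
    (((hasDerivAt_deriv_Gamma (show 0 < p + 1 by linarith)).comp_add_const p 1).ofReal_comp.add
    ((((hasDerivAt_Gamma (show 0 < p + 1 by linarith)).comp_add_const p 1).ofReal_comp).mul_const
      ((Real.pi / 2 : ℝ) * Complex.I)))
  refine (h1.unique (h2.congr_of_eventuallyEq ?_)).trans ?_
  · filter_upwards [eventually_gt_nhds hp] with q hq using rayMom_one_eq hq
  · simp only [Pi.add_apply]
    push_cast
    linear_combination (Complex.I * Complex.exp ((p * (Real.pi / 2)) * Complex.I)) *
      ((Real.pi / 2) ^ 2 * Real.Gamma (p + 1)) * Complex.I_sq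

theorem norm_I_mul_exp (t : ℝ) : ‖Complex.I * Complex.exp (t * Complex.I)‖ = 1 := by
  rw [norm_mul, Complex.norm_I, Complex.norm_exp_ofReal_mul_I, one_mul]

theorem abs_Gamma_le {p : ℝ} (hp : 0 < p) :
    |Real.Gamma (p + 1)| ≤ ‖rayMom (Real.pi / 6) 0 0 1 p‖ := by
  rw [rayMom_zero_zero one_pos hp.le, norm_mul, norm_I_mul_exp, one_mul, Real.one_rpow, one_mul,
    Complex.norm_real, Real.norm_eq_abs]

theorem abs_deriv_Gamma_le {p : ℝ} (hp : 0 < p) :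
    |deriv Real.Gamma (p + 1)| ≤ ‖rayMom (Real.pi / 6) 0 1 1 p‖ := by
  rw [rayMom_one_eq hp, norm_mul, norm_I_mul_exp, one_mul]
  refine le_trans (le_of_eq ?_) (Complex.abs_re_le_norm _)
  simp

theorem abs_iteratedDeriv_Gamma_le {p : ℝ} (hp : 0 < p) :
    |iteratedDeriv 2 Real.Gamma (p + 1)| ≤ ‖rayMom (Real.pi / 6) 0 2 1 p‖ +
      (Real.pi / 2) ^ 2 * ‖rayMom (Real.pi / 6) 0 0 1 p‖ := by
  have h1 : |iteratedDeriv 2 Real.Gamma (p + 1) - (Real.pi / 2) ^ 2 * Real.Gamma (p + 1)| ≤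
      ‖rayMom (Real.pi / 6) 0 2 1 p‖ := by
    rw [rayMom_two_eq hp, norm_mul, norm_I_mul_exp, one_mul]
    refine le_trans (le_of_eq ?_) (Complex.abs_re_le_norm _)
    rw [Complex.add_re, Complex.ofReal_re, Complex.re_ofReal_mul, Complex.I_re, mul_zero, add_zero]
  have h2 := abs_sub_abs_le_abs_sub (iteratedDeriv 2 Real.Gamma (p + 1))
    ((Real.pi / 2) ^ 2 * Real.Gamma (p + 1))
  rw [abs_mul, abs_of_nonneg (sq_nonneg (Real.pi / 2))] at h2
  have h3 := mul_le_mul_of_nonneg_left (abs_Gamma_le hp) (sq_nonneg (Real.pi / 2))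
  linarith

theorem summable_norm_rayMom_succ {α r : ℝ} (j : ℕ) (h0 : 0 < α) (h1 : α < 1) (hr : 0 ≤ r) :
    Summable fun k : ℕ => r ^ (k + 1) / (k + 1).factorial *
      ‖rayMom (Real.pi / 6) 0 j 1 (α * (k + 1 : ℕ))‖ :=
  (summable_nat_add_iff 1).2
    (summable_norm_rayMom 0 j h0 h1 hr (sin_pi_div_six_mul_pos one_pos))

theorem summable_abs_deriv_Gamma {α r : ℝ} (h0 : 0 < α) (h1 : α < 1) (hr : 0 ≤ r) :
    Summable fun k : ℕ => r ^ (k + 1) / (k + 1).factorial *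
      |deriv Real.Gamma (α * (k + 1 : ℕ) + 1)| := by
  refine Summable.of_nonneg_of_le (fun k => by positivity) (fun k => ?_)
    (summable_norm_rayMom_succ 1 h0 h1 hr)
  gcongr
  exact abs_deriv_Gamma_le (by positivity)

theorem summable_abs_iteratedDeriv_Gamma {α r : ℝ} (h0 : 0 < α) (h1 : α < 1) (hr : 0 ≤ r) :
    Summable fun k : ℕ => r ^ (k + 1) / (k + 1).factorial *
      |iteratedDeriv 2 Real.Gamma (α * (k + 1 : ℕ) + 1)| := by
  refine Summable.of_nonneg_of_le (fun k => by positivity) (fun k => ?_)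
    ((summable_norm_rayMom_succ 2 h0 h1 hr).add
      ((summable_norm_rayMom_succ 0 h0 h1 hr).mul_left ((Real.pi / 2) ^ 2)))
  rw [mul_left_comm, ← mul_add]
  gcongr
  exact abs_iteratedDeriv_Gamma_le (by positivity)

/-! ### Real parts of the moments with logarithms. -/

/-- Derivative in `p` of the closed form for `j = 0`: the sine gives the cosine term, the power
gives `-log x`, and `Γ` gives `Γ'`. -/
theorem re_rayMom_one {x p : ℝ} (hx : 0 < x) (hp : 0 < p) :
    (rayMom (Real.pi / 6) 0 1 x p).re =
      -((Real.sin (Real.pi * p / 2) * deriv Real.Gamma (p + 1) +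
        (Real.pi / 2 * Real.cos (Real.pi * p / 2) - Real.log x * Real.sin (Real.pi * p / 2)) *
          Real.Gamma (p + 1)) * x ^ (-p - 1)) := by
  have h1 := HasDerivAt.complex_re (hasDerivAt_rayMom 0 0 (θ := Real.pi / 6) (x := x)
    (show -1 / 2 < p by linarith) (sin_pi_div_six_mul_pos hx))
  have hl : HasDerivAt (fun q : ℝ => Real.pi * q / 2) (Real.pi / 2) p := by
    simpa using ((hasDerivAt_id p).const_mul Real.pi).div_const 2
  have hpow : HasDerivAt (fun q : ℝ => x ^ (-q - 1)) (-(Real.log x) * x ^ (-p - 1)) p := by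
    refine (((hasDerivAt_id p).neg.sub_const 1).const_rpow hx).congr_deriv ?_
    simp
  have hG := (hasDerivAt_Gamma (show 0 < p + 1 by linarith)).comp_add_const p 1
  have h2 := ((hl.sin).mul (hpow.mul hG)).neg
  refine (h1.unique (h2.congr_of_eventuallyEq ?_)).trans ?_
  · filter_upwards [eventually_gt_nhds hp] with q hq
    rw [re_rayMom 0 hx hq.le]
    simp
  · simp only [Pi.mul_apply]
    ring

theorem re_rayMom_two {x p : ℝ} (hx : 0 < x) (hp : 0 < p) :
    (rayMom (Real.pi / 6) 0 2 x p).re =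
      -((Real.sin (Real.pi * p / 2) * iteratedDeriv 2 Real.Gamma (p + 1) +
        2 * ((Real.pi / 2 * Real.cos (Real.pi * p / 2) -
          Real.log x * Real.sin (Real.pi * p / 2)) * deriv Real.Gamma (p + 1)) +
        ((Real.log x ^ 2 - Real.pi ^ 2 / 4) * Real.sin (Real.pi * p / 2) -
          Real.pi * Real.log x * Real.cos (Real.pi * p / 2)) * Real.Gamma (p + 1)) *
        x ^ (-p - 1)) := by
  have h1 := HasDerivAt.complex_re (hasDerivAt_rayMom 0 1 (θ := Real.pi / 6) (x := x)
    (show -1 / 2 < p by linarith) (sin_pi_div_six_mul_pos hx))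
  have hl : HasDerivAt (fun q : ℝ => Real.pi * q / 2) (Real.pi / 2) p := by
    simpa using ((hasDerivAt_id p).const_mul Real.pi).div_const 2
  have hpow : HasDerivAt (fun q : ℝ => x ^ (-q - 1)) (-(Real.log x) * x ^ (-p - 1)) p := by
    refine (((hasDerivAt_id p).neg.sub_const 1).const_rpow hx).congr_deriv ?_
    simp
  have hG := (hasDerivAt_Gamma (show 0 < p + 1 by linarith)).comp_add_const p 1
  have hG' := (hasDerivAt_deriv_Gamma (show 0 < p + 1 by linarith)).comp_add_const p 1
  have h2 := (((hl.sin.mul hG').add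
    (((hl.cos.const_mul (Real.pi / 2)).sub (hl.sin.const_mul (Real.log x))).mul hG)).mul hpow).neg
  refine (h1.unique (h2.congr_of_eventuallyEq ?_)).trans ?_
  · filter_upwards [eventually_gt_nhds hp] with q hq
    rw [re_rayMom_one hx hq]
    rfl
  · simp only [Pi.mul_apply, Pi.add_apply, Pi.sub_apply]
    ring

/-! ### The series at zero, after removal of the vanishing terms. -/

theorem HasSum.two_mul_of_odd_eq_zero {f : ℕ → ℝ} {a : ℝ} (h : HasSum f a)
    (hf : ∀ n, Odd n → f n = 0) : HasSum (fun k => f (2 * k)) a := by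
  refine (Function.Injective.hasSum_iff (mul_right_injective₀ (two_ne_zero' ℕ)) fun n hn => ?_).2 h
  refine hf n (Nat.not_even_iff_odd.1 fun he => hn ?_)
  obtain ⟨k, hk⟩ := even_iff_two_dvd.1 he
  exact ⟨k, hk.symm⟩

theorem HasSum.two_mul_add_one_of_even_eq_zero {f : ℕ → ℝ} {a : ℝ} (h : HasSum f a)
    (hf : ∀ n, Even n → f n = 0) : HasSum (fun k => f (2 * k + 1)) a := by
  have hi : Function.Injective fun k : ℕ => 2 * k + 1 := fun a b h => by simpa using h
  refine (hi.hasSum_iff fun n hn => ?_).2 h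
  refine hf n (Nat.not_odd_iff_even.1 fun ho => hn ?_)
  obtain ⟨k, hk⟩ := ho
  exact ⟨k, hk.symm⟩

theorem sum_range_two_mul_of_odd_eq_zero {f : ℕ → ℝ} (hf : ∀ n, Odd n → f n = 0) (N : ℕ) :
    ∑ n ∈ Finset.range (2 * N), f n = ∑ k ∈ Finset.range N, f (2 * k) := by
  induction N with
  | zero => simp
  | succ N ih =>
    rw [Nat.mul_succ, Finset.sum_range_succ, Finset.sum_range_succ, ih, Finset.sum_range_succ,
      hf (2 * N + 1) ⟨N, rfl⟩, add_zero]

theorem sum_range_two_mul_add_one_of_even_eq_zero {f : ℕ → ℝ} (hf : ∀ n, Even n → f n = 0)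
    (N : ℕ) : ∑ n ∈ Finset.range (2 * N + 1), f n = ∑ k ∈ Finset.range N, f (2 * k + 1) := by
  induction N with
  | zero => simpa using hf 0 (by simp)
  | succ N ih =>
    rw [Nat.mul_succ, Finset.sum_range_succ, Finset.sum_range_succ, ih, Finset.sum_range_succ,
      hf (2 * N + 1 + 1) ⟨N + 1, by ring⟩, add_zero]

/-- The `n`-th term of the Taylor expansion at zero of `∂_x^m ∂_α^j` of the density. -/
noncomputable def zeroTerm (m j : ℕ) (α : ℝ) (n : ℕ) (x : ℝ) : ℝ :=
  x ^ n / n.factorial * (1 / Real.pi * (rayInt 0 (m + n) j 0 α).re)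

theorem re_rayInt_origin_of_odd {α : ℝ} (hα : 0 < α) {n j : ℕ} (hj : j ≤ 2) (hn : Odd n) :
    (rayInt 0 n j 0 α).re = 0 := by
  interval_cases j
  · rw [re_rayInt_origin hα, I_pow_re_of_odd hn, zero_mul]
  · rw [re_rayInt_origin_one hα, I_pow_re_of_odd hn, zero_mul]
  · rw [re_rayInt_origin_two hα, I_pow_re_of_odd hn, zero_mul]

theorem zeroTerm_of_odd {α : ℝ} (hα : 0 < α) {m j n : ℕ} (hj : j ≤ 2) (hn : Odd (m + n)) (x : ℝ) :
    zeroTerm m j α n x = 0 := by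
  rw [zeroTerm, re_rayInt_origin_of_odd hα hj hn, mul_zero, mul_zero]

theorem hasSum_zeroTerm {α : ℝ} (hα : 1 < α) (m j : ℕ) (x : ℝ) :
    HasSum (fun n => zeroTerm m j α n x) (1 / Real.pi * (rayInt 0 m j x α).re) := by
  have h := (Complex.hasSum_re (hasSum_rayInt_origin hα m j x)).mul_left (1 / Real.pi)
  refine h.congr_fun fun n => ?_
  rw [zeroTerm, Complex.re_ofReal_mul]
  ring

theorem isBigO_sub_sum_zeroTerm {α : ℝ} (hα : 0 < α) (m j N : ℕ) :
    (fun x => 1 / Real.pi * (rayInt 0 m j x α).re - ∑ n ∈ Finset.range N, zeroTerm m j α n x)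
      =O[𝓝 0] fun x => x ^ N := by
  obtain ⟨C, hC⟩ := exists_norm_rayInt_sub_le hα m j N
  refine IsBigO.of_bound (1 / Real.pi * C) (Eventually.of_forall fun x => ?_)
  have h1 : 1 / Real.pi * (rayInt 0 m j x α).re - ∑ n ∈ Finset.range N, zeroTerm m j α n x =
      1 / Real.pi * (rayInt 0 m j x α - ∑ n ∈ Finset.range N,
      ((x ^ n / n.factorial : ℝ) : ℂ) * rayInt 0 (m + n) j 0 α).re := by
    rw [Complex.sub_re, Complex.re_sum, mul_sub, Finset.mul_sum]
    congr 1
    refine Finset.sum_congr rfl fun n _ => ?_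
    rw [zeroTerm, Complex.re_ofReal_mul]
    ring
  have hpi := Real.pi_pos
  rw [h1, Real.norm_eq_abs, Real.norm_eq_abs, abs_mul, abs_of_pos (by positivity), abs_pow,
    mul_assoc]
  gcongr
  exact (Complex.abs_re_le_norm _).trans (hC x)

theorem xZero_eq {α : ℝ} (hα : 0 < α) (k : ℕ) (x : ℝ) :
    xZero α (k + 1) x = zeroTerm 1 0 α (2 * k + 1) x := by
  have h1 := Real.Gamma_add_one (s := (2 * (k + 1 : ℝ) + 1) / α) (by positivity)
  rw [xZero, zeroTerm, show 1 + (2 * k + 1) = 2 * (k + 1) by ring, re_rayInt_origin hα,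
    I_pow_re_two_mul, show 2 * (k + 1) - 1 = 2 * k + 1 by omega]
  push_cast
  rw [h1]
  field_simp

theorem xxZero_eq {α : ℝ} (hα : 0 < α) (k : ℕ) (x : ℝ) :
    xxZero α (k + 1) x = zeroTerm 2 0 α (2 * k) x := by
  have h1 := Real.Gamma_add_one (s := (2 * (k + 1 : ℝ) + 1) / α) (by positivity)
  rw [xxZero, zeroTerm, show 2 + 2 * k = 2 * (k + 1) by ring, re_rayInt_origin hα,
    I_pow_re_two_mul, show 2 * (k + 1) - 2 = 2 * k by omega]
  push_cast
  rw [h1]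
  field_simp

theorem neg_sq_pow (x : ℝ) (k : ℕ) : (-(x ^ 2)) ^ k = (-1) ^ k * x ^ (2 * k) := by
  rw [neg_pow, pow_mul]

theorem aZero_eq {α : ℝ} (hα : 0 < α) (k : ℕ) (x : ℝ) :
    aZero α k x = zeroTerm 0 1 α (2 * k) x := by
  rw [aZero, zeroTerm, zero_add, re_rayInt_origin_one hα, I_pow_re_two_mul, neg_sq_pow]
  push_cast
  field_simp

theorem aaZero_eq {α : ℝ} (hα : 0 < α) (k : ℕ) (x : ℝ) :
    aaZero₁ α k x + aaZero₂ α k x = zeroTerm 0 2 α (2 * k) x := by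
  rw [aaZero₁, aaZero₂, zeroTerm, zero_add, re_rayInt_origin_two hα, I_pow_re_two_mul, neg_sq_pow]
  push_cast
  field_simp

theorem hasSum_xZero {α : ℝ} (hα : 1 < α) (x : ℝ) :
    HasSum (fun k : ℕ => xZero α (k + 1) x) (densityX x α) := by
  have h0 : 0 < α := by linarith
  simp only [densityX_eq h0, xZero_eq h0]
  exact HasSum.two_mul_add_one_of_even_eq_zero (hasSum_zeroTerm hα 1 0 x) fun n hn =>
    zeroTerm_of_odd h0 (by norm_num) (odd_one.add_even hn) x

theorem hasSum_xxZero {α : ℝ} (hα : 1 < α) (x : ℝ) :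
    HasSum (fun k : ℕ => xxZero α (k + 1) x) (densityXX x α) := by
  have h0 : 0 < α := by linarith
  simp only [densityXX_eq h0, xxZero_eq h0]
  exact HasSum.two_mul_of_odd_eq_zero (hasSum_zeroTerm hα 2 0 x) fun n hn =>
    zeroTerm_of_odd h0 (by norm_num) (even_two.add_odd hn) x

theorem hasSum_aZero {α : ℝ} (h1 : 1 < α) (h2 : α ≤ 2) (x : ℝ) :
    HasSum (fun k : ℕ => aZero α k x) (densityA x α) := by
  have h0 : 0 < α := by linarith
  simp only [densityA_eq h0 h2, aZero_eq h0]
  exact HasSum.two_mul_of_odd_eq_zero (hasSum_zeroTerm h1 0 1 x) fun n hn =>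
    zeroTerm_of_odd h0 (by norm_num) (by rwa [zero_add]) x

theorem hasSum_aaZero {α : ℝ} (h1 : 1 < α) (h2 : α ≤ 2) (x : ℝ) :
    ∃ s₁ s₂ : ℝ, HasSum (fun k : ℕ => aaZero₁ α k x) s₁ ∧ HasSum (fun k : ℕ => aaZero₂ α k x) s₂ ∧
      densityAA x α = s₁ + s₂ := by
  have h0 : 0 < α := by linarith
  have hs : HasSum (fun k : ℕ => aaZero₁ α k x + aaZero₂ α k x) (densityAA x α) := by
    simp only [densityAA_eq h0 h2, aaZero_eq h0]
    exact HasSum.two_mul_of_odd_eq_zero (hasSum_zeroTerm h1 0 2 x) fun n hn =>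
      zeroTerm_of_odd h0 (by norm_num) (by rwa [zero_add]) x
  -- The series with `Γ'` is `-2/α` times the series of `f_α`, hence convergent; the series with
  -- `Γ''` is then a difference of convergent series.
  have hs₁ : HasSum (fun k : ℕ => aaZero₁ α k x) (-(2 / α) * densityA x α) := by
    refine ((hasSum_aZero h1 h2 x).mul_left (-(2 / α))).congr_fun fun k => ?_
    rw [aaZero₁, aZero]
    field_simp
  refine ⟨_, densityAA x α - -(2 / α) * densityA x α, hs₁, ?_, by ring⟩
  exact (hs.sub hs₁).congr_fun fun k => by ring

theorem hasAsymptoticExpansion_xZero {α : ℝ} (hα : 0 < α) :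
    HasAsymptoticExpansion (fun x => densityX x α) (fun k x => xZero α (k + 1) x)
      (fun k x => x ^ (2 * k + 1)) (𝓝 0) := by
  refine ⟨fun N => isLittleO_pow_pow (by omega), fun N => ?_⟩
  simp only [densityX_eq hα, xZero_eq hα]
  -- The first `2N + 1` Taylor terms contain exactly `N` odd ones, so the gauge is that of the first
  -- omitted odd term.
  refine (isBigO_sub_sum_zeroTerm hα 1 0 (2 * N + 1)).congr_left fun x => ?_
  rw [sum_range_two_mul_add_one_of_even_eq_zero fun n hn =>
    zeroTerm_of_odd hα (by norm_num) (odd_one.add_even hn) x]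

theorem hasAsymptoticExpansion_xxZero {α : ℝ} (hα : 0 < α) :
    HasAsymptoticExpansion (fun x => densityXX x α) (fun k x => xxZero α (k + 1) x)
      (fun k x => x ^ (2 * k)) (𝓝 0) := by
  refine ⟨fun N => isLittleO_pow_pow (by omega), fun N => ?_⟩
  simp only [densityXX_eq hα, xxZero_eq hα]
  refine (isBigO_sub_sum_zeroTerm hα 2 0 (2 * N)).congr_left fun x => ?_
  rw [sum_range_two_mul_of_odd_eq_zero fun n hn =>
    zeroTerm_of_odd hα (by norm_num) (even_two.add_odd hn) x]

theorem hasAsymptoticExpansion_aZero {α : ℝ} (hα : 0 < α) (h2 : α ≤ 2) :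
    HasAsymptoticExpansion (fun x => densityA x α) (fun k x => aZero α k x)
      (fun k x => x ^ (2 * k)) (𝓝 0) := by
  refine ⟨fun N => isLittleO_pow_pow (by omega), fun N => ?_⟩
  simp only [densityA_eq hα h2, aZero_eq hα]
  refine (isBigO_sub_sum_zeroTerm hα 0 1 (2 * N)).congr_left fun x => ?_
  rw [sum_range_two_mul_of_odd_eq_zero fun n hn =>
    zeroTerm_of_odd hα (by norm_num) (by rwa [zero_add]) x]

theorem hasAsymptoticExpansion_aaZero {α : ℝ} (hα : 0 < α) (h2 : α ≤ 2) :
    HasAsymptoticExpansion (fun x => densityAA x α) (fun k x => aaZero₁ α k x + aaZero₂ α k x)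
      (fun k x => x ^ (2 * k)) (𝓝 0) := by
  refine ⟨fun N => isLittleO_pow_pow (by omega), fun N => ?_⟩
  simp only [densityAA_eq hα h2, aaZero_eq hα]
  refine (isBigO_sub_sum_zeroTerm hα 0 2 (2 * N)).congr_left fun x => ?_
  rw [sum_range_two_mul_of_odd_eq_zero fun n hn =>
    zeroTerm_of_odd hα (by norm_num) (by rwa [zero_add]) x]

/-! ### The series at infinity. -/

/-- The `k`-th term of the expansion at infinity of `∂_x^m ∂_α^j` of the density. -/
noncomputable def infTerm (m j : ℕ) (α : ℝ) (k : ℕ) (x : ℝ) : ℝ :=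
  eulerCoeff j k * (1 / Real.pi * (rayMom (Real.pi / 6) m j x (α * k)).re)

/-- For `j = 0` the sine vanishes, for `j > 0` the coefficient `0 ^ j` does. This is why the series
at infinity start at `k = 1`. -/
theorem infTerm_zero {x : ℝ} (hx : 0 < x) (m j : ℕ) (α : ℝ) : infTerm m j α 0 x = 0 := by
  rcases j.eq_zero_or_pos with rfl | hj
  · rw [infTerm, re_rayMom m hx (by simp)]
    simp
  · rw [infTerm, eulerCoeff, Nat.cast_zero, zero_pow hj.ne']
    simp

theorem hasSum_infTerm {x α : ℝ} (hx : 0 < x) (h0 : 0 < α) (h1 : α < 1) (m : ℕ) {j : ℕ}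
    (hj : j ≤ 2) :
    HasSum (fun k => infTerm m j α (k + 1) x) (1 / Real.pi * (rayInt 0 m j x α).re) := by
  rw [rayInt_eq m j hx h0 (by linarith)]
  have h := (Complex.hasSum_re (hasSum_rayInt m hj h0 h1 (sin_pi_div_six_mul_pos hx))).mul_left
    (1 / Real.pi)
  have h' : HasSum (fun k => infTerm m j α k x)
      (1 / Real.pi * (rayInt (Real.pi / 6) m j x α).re) := by
    refine h.congr_fun fun k => ?_
    rw [infTerm, Complex.re_ofReal_mul]
    ring
  simpa [infTerm_zero hx] using (hasSum_nat_add_iff' 1).2 h'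

theorem isBigO_sub_sum_infTerm {α : ℝ} (h0 : 0 < α) (h3 : α < 3) (m : ℕ) {j : ℕ} (hj : j ≤ 2)
    (N : ℕ) :
    (fun x => 1 / Real.pi * (rayInt 0 m j x α).re -
      ∑ k ∈ Finset.range N, infTerm m j α (k + 1) x) =O[atTop]
      fun x => Real.log x ^ j * x ^ (-(((N + 1 : ℕ) : ℝ) * α) - (m + 1)) := by
  -- The sum is taken over `N + 1` terms because the term of index `0` is null.
  obtain ⟨C, hC⟩ := exists_norm_rayInt_sub_rayMom_le (θ := Real.pi / 6) m hj h0
    (cos_mul_pi_div_six_pos h0 h3) (by rw [Real.sin_pi_div_six]; norm_num) (N + 1)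
  refine IsBigO.of_bound (1 / Real.pi * C) ?_
  filter_upwards [eventually_ge_atTop (Real.exp 1)] with x hx
  have hx0 : 0 < x := (Real.exp_pos 1).trans_le hx
  have hlog : 1 ≤ Real.log x := (Real.le_log_iff_exp_le hx0).2 hx
  have h1 : 1 / Real.pi * (rayInt 0 m j x α).re -
      ∑ k ∈ Finset.range N, infTerm m j α (k + 1) x =
      1 / Real.pi * (rayInt (Real.pi / 6) m j x α - ∑ k ∈ Finset.range (N + 1),
        (eulerCoeff j k : ℂ) * rayMom (Real.pi / 6) m j x (α * k)).re := by
    have h2 : ∑ k ∈ Finset.range N, infTerm m j α (k + 1) x =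
        ∑ k ∈ Finset.range (N + 1), infTerm m j α k x := by
      rw [Finset.sum_range_succ', infTerm_zero hx0, add_zero]
    rw [h2, rayInt_eq m j hx0 h0 h3, Complex.sub_re, Complex.re_sum, mul_sub, Finset.mul_sum]
    congr 1
    refine Finset.sum_congr rfl fun n _ => ?_
    rw [infTerm, Complex.re_ofReal_mul]
    ring
  have hpi := Real.pi_pos
  rw [h1, Real.norm_eq_abs, Real.norm_of_nonneg (by positivity), abs_mul,
    abs_of_pos (by positivity), mul_assoc]
  gcongr
  refine (Complex.abs_re_le_norm _).trans ((hC x hx).trans (le_of_eq ?_))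
  rw [show -((m : ℝ) + α * (N + 1 : ℕ)) - 1 = -(((N + 1 : ℕ) : ℝ) * α) - (m + 1) by ring]

theorem xInf_eq {x α : ℝ} (hx : 0 < x) (h0 : 0 < α) (k : ℕ) :
    xInf α (k + 1) x = infTerm 1 0 α (k + 1) x := by
  rw [xInf, infTerm, eulerCoeff, re_rayMom 1 hx (by positivity),
    show -(α * (k + 1 : ℕ)) - ((1 : ℕ) : ℝ) - 1 = -((k + 1 : ℕ) * α) - 2 by push_cast; ring,
    show α * (k + 1 : ℕ) + ((1 : ℕ) : ℝ) + 1 = α * (k + 1 : ℕ) + 2 by push_cast; ring,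
    ← mul_assoc Real.pi]
  ring

theorem xxInf_eq {x α : ℝ} (hx : 0 < x) (h0 : 0 < α) (k : ℕ) :
    xxInf α (k + 1) x = infTerm 2 0 α (k + 1) x := by
  rw [xxInf, infTerm, eulerCoeff, re_rayMom 2 hx (by positivity),
    show -(α * (k + 1 : ℕ)) - ((2 : ℕ) : ℝ) - 1 = -((k + 1 : ℕ) * α) - 3 by push_cast; ring,
    show α * (k + 1 : ℕ) + ((2 : ℕ) : ℝ) + 1 = α * (k + 1 : ℕ) + 3 by push_cast; ring,
    ← mul_assoc Real.pi, Nat.add_sub_cancel, pow_succ (-1 : ℝ) k]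
  ring

theorem aInf_eq {x α : ℝ} (hx : 0 < x) (h0 : 0 < α) (k : ℕ) :
    aInf₁ α (k + 1) x + aInf₂ α (k + 1) x = infTerm 0 1 α (k + 1) x := by
  rw [aInf₁, aInf₂, infTerm, eulerCoeff, re_rayMom_one hx (by positivity),
    show -(α * (k + 1 : ℕ)) - 1 = -((k + 1 : ℕ) * α) - 1 by ring,
    ← mul_assoc Real.pi, Nat.add_sub_cancel, pow_succ (-1 : ℝ) k, Nat.factorial_succ]
  push_cast
  field_simp

theorem aaInf_eq {x α : ℝ} (hx : 0 < x) (h0 : 0 < α) (k : ℕ) :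
    aaInf₁ α (k + 1) x + aaInf₂ α (k + 1) x + aaInf₃ α (k + 1) x =
      infTerm 0 2 α (k + 1) x := by
  rw [aaInf₁, aaInf₂, aaInf₃, infTerm, eulerCoeff, re_rayMom_two hx (by positivity),
    show -(α * (k + 1 : ℕ)) - 1 = -((k + 1 : ℕ) * α) - 1 by ring,
    ← mul_assoc Real.pi, Nat.add_sub_cancel, pow_succ (-1 : ℝ) k, Nat.factorial_succ]
  push_cast
  field_simp

theorem isLittleO_rpow_atTop {a b : ℝ} (h : a < b) :
    (fun x : ℝ => x ^ a) =o[atTop] fun x => x ^ b := by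
  refine isLittleO_of_tendsto' ?_ ?_
  · filter_upwards [eventually_gt_atTop 0] with x hx h0
    exact absurd h0 (Real.rpow_pos_of_pos hx b).ne'
  · refine (tendsto_rpow_neg_atTop (sub_pos.2 h)).congr' ?_
    filter_upwards [eventually_gt_atTop 0] with x hx
    rw [← Real.rpow_sub hx]
    congr 1
    ring

theorem isLittleO_gauge_atTop {α : ℝ} (hα : 0 < α) (c : ℝ) (N : ℕ) :
    (fun x : ℝ => x ^ (-(((N + 1 + 1 : ℕ) : ℝ) * α) - c)) =o[atTop]
      fun x => x ^ (-(((N + 1 : ℕ) : ℝ) * α) - c) := by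
  refine isLittleO_rpow_atTop ?_
  push_cast
  linarith

theorem hasAsymptoticExpansion_xInf {α : ℝ} (h0 : 0 < α) (h3 : α < 3) :
    HasAsymptoticExpansion (fun x => densityX x α) (fun k x => xInf α (k + 1) x)
      (fun k x => x ^ (-(((k + 1 : ℕ) : ℝ) * α) - 2)) atTop := by
  refine ⟨isLittleO_gauge_atTop h0 2, fun N => ?_⟩
  refine (isBigO_sub_sum_infTerm h0 h3 1 (j := 0) (by norm_num) N).congr' ?_ ?_
  · filter_upwards [eventually_gt_atTop 0] with x hx
    simp only [densityX_eq h0, xInf_eq hx h0]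
  · refine Eventually.of_forall fun x => ?_
    norm_num

theorem hasAsymptoticExpansion_xxInf {α : ℝ} (h0 : 0 < α) (h3 : α < 3) :
    HasAsymptoticExpansion (fun x => densityXX x α) (fun k x => xxInf α (k + 1) x)
      (fun k x => x ^ (-(((k + 1 : ℕ) : ℝ) * α) - 3)) atTop := by
  refine ⟨isLittleO_gauge_atTop h0 3, fun N => ?_⟩
  refine (isBigO_sub_sum_infTerm h0 h3 2 (j := 0) (by norm_num) N).congr' ?_ ?_
  · filter_upwards [eventually_gt_atTop 0] with x hx
    simp only [densityXX_eq h0, xxInf_eq hx h0]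
  · refine Eventually.of_forall fun x => ?_
    norm_num

theorem hasAsymptoticExpansion_aInf {α : ℝ} (h0 : 0 < α) (h2 : α ≤ 2) :
    HasAsymptoticExpansion (fun x => densityA x α)
      (fun k x => aInf₁ α (k + 1) x + aInf₂ α (k + 1) x)
      (fun k x => Real.log x * x ^ (-(((k + 1 : ℕ) : ℝ) * α) - 1)) atTop := by
  refine ⟨fun N => (isBigO_refl _ _).mul_isLittleO (isLittleO_gauge_atTop h0 1 N), fun N => ?_⟩
  refine (isBigO_sub_sum_infTerm h0 (by linarith) 0 (j := 1) (by norm_num) N).congr' ?_ ?_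
  · filter_upwards [eventually_gt_atTop 0] with x hx
    simp only [densityA_eq h0 h2, aInf_eq hx h0]
  · refine Eventually.of_forall fun x => ?_
    norm_num

theorem hasAsymptoticExpansion_aaInf {α : ℝ} (h0 : 0 < α) (h2 : α ≤ 2) :
    HasAsymptoticExpansion (fun x => densityAA x α)
      (fun k x => aaInf₁ α (k + 1) x + aaInf₂ α (k + 1) x + aaInf₃ α (k + 1) x)
      (fun k x => Real.log x ^ 2 * x ^ (-(((k + 1 : ℕ) : ℝ) * α) - 1)) atTop := by
  refine ⟨fun N => (isBigO_refl _ _).mul_isLittleO (isLittleO_gauge_atTop h0 1 N), fun N => ?_⟩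
  refine (isBigO_sub_sum_infTerm h0 (by linarith) 0 (j := 2) le_rfl N).congr' ?_ ?_
  · filter_upwards [eventually_gt_atTop 0] with x hx
    simp only [densityAA_eq h0 h2, aaInf_eq hx h0]
  · refine Eventually.of_forall fun x => ?_
    norm_num

/-! ### Separate convergence of the series at infinity. -/

theorem summable_mul_rpow {x α M : ℝ} (hx : 0 < x) {g d : ℕ → ℝ}
    (hg : ∀ r : ℝ, 0 ≤ r → Summable fun k : ℕ => r ^ (k + 1) / (k + 1).factorial * |g k|)
    (hd : ∀ k, |d k| ≤ M) :
    Summable fun k : ℕ => g k / k.factorial * (k + 1 : ℕ) * d k *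
      x ^ (-((k + 1 : ℕ) * α) - 1) := by
  -- Since `(k+1)/k! = (k+1)²/(k+1)!` and `(k+1)² ≤ 4^(k+1)`, the polynomial factor goes into the
  -- ratio `4 x^(-α)`.
  refine Summable.of_norm_bounded ((hg (4 * x ^ (-α)) (by positivity)).mul_left (M * x⁻¹))
    fun k => ?_
  have h1 : x ^ (-((k + 1 : ℕ) * α) - 1) = (x ^ (-α)) ^ (k + 1) * x⁻¹ := by
    rw [Real.rpow_sub hx, Real.rpow_one, ← Real.rpow_natCast, ← Real.rpow_mul hx.le,
      div_eq_mul_inv]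
    ring_nf
  have h2 : ((k + 1 : ℕ) : ℝ) ^ 2 ≤ 4 ^ (k + 1) := by
    have : ((k + 1 : ℕ) : ℝ) ≤ 2 ^ (k + 1) := by exact_mod_cast (k + 1).lt_two_pow_self.le
    calc _ ≤ ((2 : ℝ) ^ (k + 1)) ^ 2 := by gcongr
      _ = _ := by rw [← pow_mul, mul_comm, pow_mul]; norm_num
  have hM : 0 ≤ M := (abs_nonneg _).trans (hd 0)
  rw [h1, Real.norm_eq_abs, abs_mul, abs_mul, abs_mul, abs_div, Nat.abs_cast, Nat.abs_cast,
    abs_of_nonneg (show 0 ≤ (x ^ (-α)) ^ (k + 1) * x⁻¹ by positivity), Nat.factorial_succ, mul_pow]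
  calc _ ≤ |g k| / k.factorial * (k + 1 : ℕ) * M * ((x ^ (-α)) ^ (k + 1) * x⁻¹) := by
        gcongr
        exact hd k
    _ = M * x⁻¹ * (((k + 1 : ℕ) : ℝ) ^ 2 * (x ^ (-α)) ^ (k + 1) / ((k + 1) * k.factorial : ℕ) *
          |g k|) := by
        push_cast
        field_simp
    _ ≤ _ := by gcongr

theorem abs_cos_sub_sin_le (x t : ℝ) :
    |Real.pi / 2 * Real.cos t - Real.log x * Real.sin t| ≤ Real.pi / 2 + |Real.log x| := by
  have hpi := Real.pi_pos
  refine (abs_sub _ _).trans (add_le_add ?_ ?_)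
  · rw [abs_mul, abs_of_pos (by positivity)]
    exact mul_le_of_le_one_right (by positivity) (Real.abs_cos_le_one t)
  · rw [abs_mul]
    exact mul_le_of_le_one_right (abs_nonneg _) (Real.abs_sin_le_one t)

theorem abs_neg_one_pow_mul (k : ℕ) (t : ℝ) : |(-1) ^ k * t| = |t| := by
  rw [abs_mul, abs_neg_one_pow, one_mul]

theorem summable_aInf₁ {x α : ℝ} (hx : 0 < x) (h0 : 0 < α) (h1 : α < 1) :
    Summable fun k : ℕ => aInf₁ α (k + 1) x := by
  refine (summable_mul_rpow hx (M := 1 / Real.pi) (α := α)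
    -- The division by `k + 1` cancels the factor `k + 1` that the general summability lemma carries
    -- for the series of `f_αα`.
    (d := fun k => (-1) ^ k *
      (1 / Real.pi * (Real.sin (Real.pi * α * (k + 1 : ℕ) / 2) / (k + 1 : ℕ))))
    (fun r hr => summable_abs_deriv_Gamma h0 h1 hr) fun k => ?_).congr fun k => ?_
  · have hpi := Real.pi_pos
    rw [abs_neg_one_pow_mul, abs_mul, abs_of_pos (by positivity), abs_div, Nat.abs_cast]
    refine mul_le_of_le_one_right (by positivity) (div_le_one_of_le₀
      ((Real.abs_sin_le_one _).trans ?_) (by positivity))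
    exact_mod_cast k.succ_pos
  · rw [aInf₁, Nat.add_sub_cancel]
    field_simp

theorem summable_aaInf₁ {x α : ℝ} (hx : 0 < x) (h0 : 0 < α) (h1 : α < 1) :
    Summable fun k : ℕ => aaInf₁ α (k + 1) x := by
  refine (summable_mul_rpow hx (M := 1 / Real.pi) (α := α)
    (d := fun k => (-1) ^ k * (1 / Real.pi * Real.sin (Real.pi * α * (k + 1 : ℕ) / 2)))
    (fun r hr => summable_abs_iteratedDeriv_Gamma h0 h1 hr) fun k => ?_).congr fun k => ?_
  · have hpi := Real.pi_pos
    rw [abs_neg_one_pow_mul, abs_mul, abs_of_pos (by positivity)]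
    exact mul_le_of_le_one_right (by positivity) (Real.abs_sin_le_one _)
  · rw [aaInf₁, Nat.add_sub_cancel]
    ring

theorem summable_aaInf₂ {x α : ℝ} (hx : 0 < x) (h0 : 0 < α) (h1 : α < 1) :
    Summable fun k : ℕ => aaInf₂ α (k + 1) x := by
  refine (summable_mul_rpow hx (M := 2 / Real.pi * (Real.pi / 2 + |Real.log x|)) (α := α)
    (d := fun k => (-1) ^ k * (2 / Real.pi *
      (Real.pi / 2 * Real.cos (Real.pi * α * (k + 1 : ℕ) / 2) -
        Real.log x * Real.sin (Real.pi * α * (k + 1 : ℕ) / 2))))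
    (fun r hr => summable_abs_deriv_Gamma h0 h1 hr) fun k => ?_).congr fun k => ?_
  · have hpi := Real.pi_pos
    rw [abs_neg_one_pow_mul, abs_mul, abs_of_pos (by positivity)]
    gcongr
    exact abs_cos_sub_sin_le x _
  · rw [aaInf₂, Nat.add_sub_cancel, pow_succ (-1 : ℝ) k]
    ring

theorem hasSum_xInf {x α : ℝ} (hx : 0 < x) (h0 : 0 < α) (h1 : α < 1) :
    HasSum (fun k : ℕ => xInf α (k + 1) x) (densityX x α) := by
  simp only [densityX_eq h0, xInf_eq hx h0]
  exact hasSum_infTerm hx h0 h1 1 (by norm_num)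

theorem hasSum_xxInf {x α : ℝ} (hx : 0 < x) (h0 : 0 < α) (h1 : α < 1) :
    HasSum (fun k : ℕ => xxInf α (k + 1) x) (densityXX x α) := by
  simp only [densityXX_eq h0, xxInf_eq hx h0]
  exact hasSum_infTerm hx h0 h1 2 (by norm_num)

/-- The combined series converges to the derivative and the one with `Γ'` converges by itself, so
the one with `Γ` converges by subtraction. -/
theorem hasSum_aInf {x α : ℝ} (hx : 0 < x) (h0 : 0 < α) (h1 : α < 1) :
    ∃ s₁ s₂ : ℝ, HasSum (fun k : ℕ => aInf₁ α (k + 1) x) s₁ ∧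
      HasSum (fun k : ℕ => aInf₂ α (k + 1) x) s₂ ∧ densityA x α = s₁ + s₂ := by
  have hs : HasSum (fun k : ℕ => aInf₁ α (k + 1) x + aInf₂ α (k + 1) x) (densityA x α) := by
    simp only [densityA_eq h0 (show α ≤ 2 by linarith), aInf_eq hx h0]
    exact hasSum_infTerm hx h0 h1 0 (by norm_num)
  have hs₁ := (summable_aInf₁ hx h0 h1).hasSum
  exact ⟨_, _, hs₁, (hs.sub hs₁).congr_fun fun k => by ring, by ring⟩

theorem hasSum_aaInf {x α : ℝ} (hx : 0 < x) (h0 : 0 < α) (h1 : α < 1) :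
    ∃ s₁ s₂ s₃ : ℝ, HasSum (fun k : ℕ => aaInf₁ α (k + 1) x) s₁ ∧
      HasSum (fun k : ℕ => aaInf₂ α (k + 1) x) s₂ ∧
      HasSum (fun k : ℕ => aaInf₃ α (k + 1) x) s₃ ∧ densityAA x α = s₁ + s₂ + s₃ := by
  have hs : HasSum (fun k : ℕ => aaInf₁ α (k + 1) x + aaInf₂ α (k + 1) x + aaInf₃ α (k + 1) x)
      (densityAA x α) := by
    simp only [densityAA_eq h0 (show α ≤ 2 by linarith), aaInf_eq hx h0]
    exact hasSum_infTerm hx h0 h1 0 le_rfl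
  have hs₁ := (summable_aaInf₁ hx h0 h1).hasSum
  have hs₂ := (summable_aaInf₂ hx h0 h1).hasSum
  exact ⟨_, _, _, hs₁, hs₂, (hs.sub (hs₁.add hs₂)).congr_fun fun k => by ring, by ring⟩

/-! ### Parity in `x`. -/

theorem density_neg (x α : ℝ) : density (-x) α = density x α := by
  simp only [density, mul_neg, Real.cos_neg]

theorem densityX_neg (x α : ℝ) : densityX (-x) α = -densityX x α := by
  have h := deriv_comp_neg (fun y => density y α) x
  simp only [density_neg] at h
  rw [densityX, densityX, h, neg_neg]

theorem densityXX_neg (x α : ℝ) : densityXX (-x) α = densityXX x α := by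
  have h := iteratedDeriv_comp_neg 2 (fun y => density y α) x
  simp only [density_neg] at h
  rw [densityXX, densityXX, h]
  simp

theorem densityA_neg (x α : ℝ) : densityA (-x) α = densityA x α := by
  simp only [densityA, density_neg]

theorem densityAA_neg (x α : ℝ) : densityAA (-x) α = densityAA x α := by
  simp only [densityAA, density_neg]

theorem densityX_eq_sign_mul {x : ℝ} (hx : x ≠ 0) (α : ℝ) :
    densityX x α = Real.sign x * densityX |x| α := by
  rcases hx.lt_or_gt with h | h
  · rw [Real.sign_of_neg h, abs_of_neg h, densityX_neg]
    ring
  · rw [Real.sign_of_pos h, abs_of_pos h, one_mul]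

theorem densityXX_abs (x α : ℝ) : densityXX |x| α = densityXX x α := by
  rcases abs_choice x with h | h <;> rw [h]
  exact densityXX_neg x α

theorem densityA_abs (x α : ℝ) : densityA |x| α = densityA x α := by
  rcases abs_choice x with h | h <;> rw [h]
  exact densityA_neg x α

theorem densityAA_abs (x α : ℝ) : densityAA |x| α = densityAA x α := by
  rcases abs_choice x with h | h <;> rw [h]
  exact densityAA_neg x α

end SymStable

theorem mainTheorem4 :
    -- the derivatives in question exist
    (∀ α : ℝ, 0 < α → α ≤ 2 → ContDiff ℝ 2 (fun x => SymStable.density x α)) ∧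
    (∀ x : ℝ, ContDiffOn ℝ 2 (fun α => SymStable.density x α) (Set.Ioc 0 2)) ∧
    -- `1 < α ≤ 2`: the series at zero converge for every `x`
    (∀ α : ℝ, 1 < α → α ≤ 2 →
      (∀ x : ℝ,
        HasSum (fun k : ℕ => SymStable.xZero α (k + 1) x) (SymStable.densityX x α) ∧
        HasSum (fun k : ℕ => SymStable.xxZero α (k + 1) x) (SymStable.densityXX x α) ∧
        HasSum (fun k : ℕ => SymStable.aZero α k x) (SymStable.densityA x α) ∧
        (∃ s₁ s₂ : ℝ,
          HasSum (fun k : ℕ => SymStable.aaZero₁ α k x) s₁ ∧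
          HasSum (fun k : ℕ => SymStable.aaZero₂ α k x) s₂ ∧
          SymStable.densityAA x α = s₁ + s₂)) ∧
      -- and the series at infinity are asymptotic expansions
      SymStable.HasAsymptoticExpansion (fun x => SymStable.densityX x α)
        (fun k x => SymStable.xInf α (k + 1) x)
        (fun k x => x ^ (-(((k + 1 : ℕ) : ℝ) * α) - 2)) atTop ∧
      SymStable.HasAsymptoticExpansion (fun x => SymStable.densityXX x α)
        (fun k x => SymStable.xxInf α (k + 1) x)
        (fun k x => x ^ (-(((k + 1 : ℕ) : ℝ) * α) - 3)) atTop ∧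
      SymStable.HasAsymptoticExpansion (fun x => SymStable.densityA x α)
        (fun k x => SymStable.aInf₁ α (k + 1) x + SymStable.aInf₂ α (k + 1) x)
        (fun k x => Real.log x * x ^ (-(((k + 1 : ℕ) : ℝ) * α) - 1)) atTop ∧
      SymStable.HasAsymptoticExpansion (fun x => SymStable.densityAA x α)
        (fun k x => SymStable.aaInf₁ α (k + 1) x + SymStable.aaInf₂ α (k + 1) x +
          SymStable.aaInf₃ α (k + 1) x)
        (fun k x => Real.log x ^ 2 * x ^ (-(((k + 1 : ℕ) : ℝ) * α) - 1)) atTop) ∧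
    -- `0 < α < 1`: the series at infinity converge for every `x ≠ 0`
    (∀ α : ℝ, 0 < α → α < 1 →
      (∀ x : ℝ, x ≠ 0 →
        HasSum (fun k : ℕ => Real.sign x * SymStable.xInf α (k + 1) |x|)
          (SymStable.densityX x α) ∧
        HasSum (fun k : ℕ => SymStable.xxInf α (k + 1) |x|) (SymStable.densityXX x α) ∧
        (∃ s₁ s₂ : ℝ,
          HasSum (fun k : ℕ => SymStable.aInf₁ α (k + 1) |x|) s₁ ∧
          HasSum (fun k : ℕ => SymStable.aInf₂ α (k + 1) |x|) s₂ ∧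
          SymStable.densityA x α = s₁ + s₂) ∧
        (∃ s₁ s₂ s₃ : ℝ,
          HasSum (fun k : ℕ => SymStable.aaInf₁ α (k + 1) |x|) s₁ ∧
          HasSum (fun k : ℕ => SymStable.aaInf₂ α (k + 1) |x|) s₂ ∧
          HasSum (fun k : ℕ => SymStable.aaInf₃ α (k + 1) |x|) s₃ ∧
          SymStable.densityAA x α = s₁ + s₂ + s₃)) ∧
      -- and the series at zero are asymptotic expansions
      SymStable.HasAsymptoticExpansion (fun x => SymStable.densityX x α)
        (fun k x => SymStable.xZero α (k + 1) x) (fun k x => x ^ (2 * k + 1)) (𝓝 0) ∧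
      SymStable.HasAsymptoticExpansion (fun x => SymStable.densityXX x α)
        (fun k x => SymStable.xxZero α (k + 1) x) (fun k x => x ^ (2 * k)) (𝓝 0) ∧
      SymStable.HasAsymptoticExpansion (fun x => SymStable.densityA x α)
        (fun k x => SymStable.aZero α k x) (fun k x => x ^ (2 * k)) (𝓝 0) ∧
      SymStable.HasAsymptoticExpansion (fun x => SymStable.densityAA x α)
        (fun k x => SymStable.aaZero₁ α k x + SymStable.aaZero₂ α k x)
        (fun k x => x ^ (2 * k)) (𝓝 0)) := by
  refine ⟨fun α h0 _ => SymStable.contDiff_density h0, SymStable.contDiffOn_density,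
    fun α h1 h2 => ?_, fun α h0 h1 => ?_⟩
  · have h0 : 0 < α := by linarith
    exact ⟨fun x => ⟨SymStable.hasSum_xZero h1 x, SymStable.hasSum_xxZero h1 x,
        SymStable.hasSum_aZero h1 h2 x, SymStable.hasSum_aaZero h1 h2 x⟩,
      SymStable.hasAsymptoticExpansion_xInf h0 (by linarith),
      SymStable.hasAsymptoticExpansion_xxInf h0 (by linarith),
      SymStable.hasAsymptoticExpansion_aInf h0 h2, SymStable.hasAsymptoticExpansion_aaInf h0 h2⟩
  · have h2 : α ≤ 2 := by linarith
    refine ⟨fun x hx => ?_, SymStable.hasAsymptoticExpansion_xZero h0,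
      SymStable.hasAsymptoticExpansion_xxZero h0, SymStable.hasAsymptoticExpansion_aZero h0 h2,
      SymStable.hasAsymptoticExpansion_aaZero h0 h2⟩
    have hx' : 0 < |x| := abs_pos.2 hx
    rw [SymStable.densityX_eq_sign_mul hx, ← SymStable.densityXX_abs, ← SymStable.densityA_abs,
      ← SymStable.densityAA_abs]
    exact ⟨(SymStable.hasSum_xInf hx' h0 h1).mul_left _, SymStable.hasSum_xxInf hx' h0 h1,
      SymStable.hasSum_aInf hx' h0 h1, SymStable.hasSum_aaInf hx' h0 h1⟩
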